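/- Let $q=2^r$ with $r\ge 1$. Let $$Sp(2n,q)=\{w\in GL(2n,q): {}^twJw=J\},\qquad J=\begin{bmatrix}0&1_n\\1_n&0\end{bmatrix},$$ let $P=P(2n,q)$ be its maximal parabolic subgroup consisting of all products $$\begin{bmatrix}A&0\\0&{}^tA^{-1}\end{bmatrix}\begin{bmatrix}1_n&B\\0&1_n\end{bmatrix}\qquad(A\in GL(n,q),\ {}^tB=B),$$ and for $0\le s\le n$ let $$\sigma_s=\begin{bmatrix}0&0&1_s&0\\0&1_{n-s}&0&0\\1_s&0&0&0\\0&0&0&1_{n-s}\end{bmatrix}\in Sp(2n,q).$$ Put $DC^-(n,q)=P\sigma_{n-1}P$ and, for $n\ge2$, $DC^+(n,q)=P\sigma_{n-2}P$. With $\left[{n\atop s}\right]_q=\prod_{j=0}^{s-1}\frac{q^{n-j}-1}{q^{s-j}-1}$, put $$A^-(n,q)=q^{\frac14(5n^2-1)}\left[{n\atop 1}\right]_q\prod_{j=1}^{(n-1)/2}(q^{2j-1}-1)\quad(n\text{ odd}),$$ $$A^+(n,q)=q^{\frac14(5n^2-2n)}\left[{n\atop 2}\right]_q\prod_{j=1}^{(n-2)/2}(q^{2j-1}-1)\quad(n\ge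 2\text{ even}).$$ For an additive character $\psi$ of $\mathbb F_q$ and $a\in\mathbb F_q^*$ put $$K_m(\psi;a)=\sum_{\alpha_1,\dots,\alpha_m\in\mathbb F_q^*}\psi(\alpha_1+\cdots+\alpha_m+a\alpha_1^{-1}\cdots\alpha_m^{-1}),\qquad K(\psi;a)=K_1(\psi;a),$$ $$K_{GL(t,q)}(\psi;a)=\sum_{w\in GL(t,q)}\psi(\mathrm{Tr}\,w+a\,\mathrm{Tr}\,w^{-1}).$$ (i) Let $\psi$ be any nontrivial additive character of $\mathbb F_q$. Then for every odd $n\ge1$ $$\sum_{w\in DC^-(n,q)}\psi(\mathrm{Tr}\,w)=A^-(n,q)K(\psi;1),$$ and for every even $n\ge2$ $$\sum_{w\in DC^+(n,q)}\psi(\mathrm{Tr}\,w)=q^{-1}A^+(n,q)K_{GL(2,q)}(\psi;1)=A^+(n,q)\bigl(K(\psi;1)^2+q^2-q\bigr).$$ (ii) Let $\lambda(x)=(-1)^{\mathrm{tr}(x)}$ be the canonical additive character of $\mathbb F_q$, where $\mathrm{tr}(x)=x+x^2+\cdots+x^{2^{r-1}}$ is the trace $\mathbb F_q\to\mathbb F_2$,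 and let $a\in\mathbb F_q^*$. Then for every odd $n\ge1$ $$\sum_{w\in DC^-(n,q)}\lambda(a\,\mathrm{Tr}\,w)=A^-(n,q)K(\lambda;a),$$ and for every even $n\ge2$ $$\sum_{w\in DC^+(n,q)}\lambda(a\,\mathrm{Tr}\,w)=A^+(n,q)\bigl(K(\lambda;a)^2+q^2-q\bigr)=A^+(n,q)\bigl(K_2(\lambda;a)+q^2\bigr).$$ -/

import Mathlib

open scoped Matrix

section Symplectic

variable (n : ℕ) (F : Type*) [Field F]

/-- The maximal parabolic subgroup `P(2n,q)` of `Sp(2n,q)`, as a set: all products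
`[[A, 0], [0, ᵗA⁻¹]] * [[1, B], [0, 1]]` with `A` invertible and `B` symmetric.
(In characteristic two Mathlib's form `[[0, -1], [1, 0]]` is `[[0, 1], [1, 0]]`.) -/
def siegelParabolic : Set (Matrix.symplecticGroup (Fin n) F) :=
  {w | ∃ (A : GL (Fin n) F) (B : Matrix (Fin n) (Fin n) F), Bᵀ = B ∧
    (w : Matrix (Fin n ⊕ Fin n) (Fin n ⊕ Fin n) F) =
      Matrix.fromBlocks (A : Matrix (Fin n) (Fin n) F) 0 0
          ((A⁻¹ : GL (Fin n) F) : Matrix (Fin n) (Fin n) F)ᵀ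
        * Matrix.fromBlocks 1 B 0 1}

/-- The matrix `σ_r`, with rows and columns grouped in blocks of sizes `r, n-r, r, n-r`:
`[[0,0,1,0], [0,1,0,0], [1,0,0,0], [0,0,0,1]]`. -/
def sigmaMatrix (r : ℕ) : Matrix (Fin n ⊕ Fin n) (Fin n ⊕ Fin n) F :=
  Matrix.fromBlocks
    (Matrix.diagonal fun i => if i.val < r then 0 else 1)
    (Matrix.diagonal fun i => if i.val < r then 1 else 0)
    (Matrix.diagonal fun i => if i.val < r then 1 else 0)
    (Matrix.diagonal fun i => if i.val < r then 0 else 1)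

theorem sigmaMatrix_mem [CharP F 2] (r : ℕ) :
    sigmaMatrix n F r ∈ Matrix.symplecticGroup (Fin n) F := by
  have hJ : Matrix.J (Fin n) F =
      Matrix.fromBlocks 0 (Matrix.diagonal fun _ => 1) (Matrix.diagonal fun _ => 1) 0 := by
    ext i j
    rcases i with i | i <;> rcases j with j | j <;>
      simp [Matrix.J, Matrix.one_apply, CharTwo.neg_eq]
  rw [SymplecticGroup.mem_iff, hJ, sigmaMatrix]
  simp only [Matrix.fromBlocks_transpose, Matrix.diagonal_transpose, Matrix.fromBlocks_multiply,
    Matrix.diagonal_mul_diagonal, Matrix.mul_zero, zero_add, add_zero, Matrix.diagonal_add]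
  congr 1
  · rw [Matrix.diagonal_eq_zero]
    funext i
    by_cases h : i.val < r <;> simp [h]
  · congr 1
    funext i
    by_cases h : i.val < r <;> simp [h]
  · congr 1
    funext i
    by_cases h : i.val < r <;> simp [h]
  · rw [Matrix.diagonal_eq_zero]
    funext i
    by_cases h : i.val < r <;> simp [h]

/-- `σ_r` as an element of `Sp(2n,q)`. -/
def sigma [CharP F 2] (r : ℕ) : Matrix.symplecticGroup (Fin n) F :=
  ⟨sigmaMatrix n F r, sigmaMatrix_mem n F r⟩

/-- The double coset `P σ_r P` in `Sp(2n,q)`, as a finite set. -/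
noncomputable def bruhatCell [Finite F] [CharP F 2] (r : ℕ) :
    Finset (Matrix.symplecticGroup (Fin n) F) :=
  (Set.toFinite (DoubleCoset.doubleCoset (sigma n F r)
    (siegelParabolic n F) (siegelParabolic n F))).toFinset

/-- `DC⁻(n,q) = P σ_{n-1} P`, used for odd `n`. -/
noncomputable def DCminus [Finite F] [CharP F 2] : Finset (Matrix.symplecticGroup (Fin n) F) :=
  bruhatCell n F (n - 1)

/-- `DC⁺(n,q) = P σ_{n-2} P`, used for even `n ≥ 2`. -/
noncomputable def DCplus [Finite F] [CharP F 2] : Finset (Matrix.symplecticGroup (Fin n) F) :=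
  bruhatCell n F (n - 2)

end Symplectic

section Constants

variable {K : Type*} [Field K]

/-- The `q`-binomial coefficient `∏_{j=0}^{r-1} (q^{n-j} - 1)/(q^{r-j} - 1)`, for `r ≤ n`. -/
def qBinomial (n r : ℕ) (q : K) : K :=
  ∏ j ∈ Finset.range r, (q ^ (n - j) - 1) / (q ^ (r - j) - 1)

/-- `A⁻(n,q)`, for odd `n`; then `5n² - 1` is divisible by `4`. -/
def Aminus (n : ℕ) (q : K) : K :=
  q ^ ((5 * n ^ 2 - 1) / 4) * qBinomial n 1 q *
    ∏ j ∈ Finset.Icc 1 ((n - 1) / 2), (q ^ (2 * j - 1) - 1)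

/-- `A⁺(n,q)`, for even `n ≥ 2`; then `5n² - 2n` is divisible by `4`. -/
def Aplus (n : ℕ) (q : K) : K :=
  q ^ ((5 * n ^ 2 - 2 * n) / 4) * qBinomial n 2 q *
    ∏ j ∈ Finset.Icc 1 ((n - 2) / 2), (q ^ (2 * j - 1) - 1)

end Constants

section Characters

variable {F : Type*} [Field F] [Fintype F] [DecidableEq F]

/-- The `m`-dimensional Kloosterman sum `K_m(ψ;a)`. -/
noncomputable def multiKloosterman (m : ℕ) (ψ : AddChar F ℂ) (a : Fˣ) : ℂ :=
  ∑ α : Fin m → Fˣ, ψ ((∑ i, (α i : F)) + (a : F) * ∏ i, (α i : F)⁻¹)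

/-- The Kloosterman sum `K(ψ;a) = ∑_{α ≠ 0} ψ(α + a α⁻¹)`. -/
noncomputable def kloosterman (ψ : AddChar F ℂ) (a : Fˣ) : ℂ :=
  ∑ α : Fˣ, ψ ((α : F) + (a : F) * (α : F)⁻¹)

/-- The Kloosterman sum `K_{GL(t,q)}(ψ;a)` for `GL(t,q)`. -/
noncomputable def kloostermanGL (t : ℕ) (ψ : AddChar F ℂ) (a : Fˣ) : ℂ :=
  ∑ w : GL (Fin t) F, ψ (Matrix.trace (w : Matrix (Fin t) (Fin t) F) +
    (a : F) * Matrix.trace ((w⁻¹ : GL (Fin t) F) : Matrix (Fin t) (Fin t) F))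

/-- The canonical additive character `λ(x) = (-1)^{tr(x)}`, where `tr` is the trace
from the finite field `F` of characteristic two to its prime field. -/
noncomputable def canonicalChar (F : Type*) [Field F] [CharP F 2] : AddChar F ℂ :=
  letI : Algebra (ZMod 2) F := ZMod.algebra F 2
  (AddChar.zmodChar 2 (neg_one_sq : (-1 : ℂ) ^ 2 = 1)).compAddMonoidHom
    (Algebra.trace (ZMod 2) F).toAddMonoidHom

end Characters

/-! Put `σ = σ_r` with `n = r + k`, where `k` is 1 or 2 and `r` is even. Since `w ↦ ψ(Tr w)` is a
class function, its sum over `PσP` is `|P| / |P ∩ σPσ⁻¹|` times `∑_{h ∈ P} ψ(Tr hσ)`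
(`card_mul_sum_doubleCoset`). Write `h` through its Levi part `A` and symmetric part `B`. Then `Tr
hσ` is `Tr A₂₂ + Tr (A⁻¹)₂₂` plus a term linear in `B`, the trace pairing of `B` with `[[A₁₁, A₁₂],
[0, 0]]`. Summing over `B` kills every `A` for which that matrix is not alternating, which leaves
`A₁₂ = 0` and `A₁₁` alternating. So `A` is block lower triangular, `(A⁻¹)₂₂ = A₂₂⁻¹`, and the sum
splits into the number of invertible alternating `r × r` matrices, a power of `q`, and the
Kloosterman sum for `GL(k,q)` (`sum_siegel_mul_sigma`, `sum_bruhatCell`). The alternating count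
comes from a recursion in steps of two (`invertibleAlternatingCard_fin_even`), and `K_{GL(2,q)}` is
computed directly (`kloostermanGL_two`).

The statement for `λ` is the case `ψ = λ(a·)`. Invariance of `λ` under Frobenius gives `K(λ(a·);1) =
K(λ;a)` (`kloosterman_mulShift`), and counting roots of Artin–Schreier equations gives `K² = K₂ + q`
(`kloosterman_sq_eq`). -/

open scoped Matrix

/-! ### Kloosterman sums over the field and over GL(1) and GL(2). -/

section Kloosterman

variable {F : Type*} [Field F]

theorem sum_matrix_two_eq {R : Type*} [Fintype R] (f : Matrix (Fin 2) (Fin 2) R → ℂ) :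
    ∑ M, f M = ∑ a, ∑ d, ∑ b, ∑ c, f !![a, b; c, d] := by
  rw [← Fintype.sum_prod_type', ← Fintype.sum_prod_type', ← Fintype.sum_prod_type']
  refine Fintype.sum_equiv ⟨fun M => (((M 0 0, M 1 1), M 0 1), M 1 0),
    fun p => !![p.1.1.1, p.1.2; p.2, p.1.1.2], fun M => ?_, fun p => ?_⟩ _ _ fun M => ?_
  · exact (Matrix.eta_fin_two M).symm
  · simp
  · simpa using congrArg f (Matrix.eta_fin_two M)

theorem trace_inv_fin_two (M : Matrix (Fin 2) (Fin 2) F) :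
    (M⁻¹).trace = M.trace * M.det⁻¹ := by
  rw [Matrix.inv_def, Matrix.trace_smul, Matrix.adjugate_fin_two, Matrix.trace_fin_two,
    Matrix.trace_fin_two, Ring.inverse_eq_inv']
  simp
  ring

variable [Fintype F] [DecidableEq F]

theorem sum_units_eq_sum_ite (f : F → ℂ) :
    ∑ u : Fˣ, f u = ∑ x : F, if x = 0 then 0 else f x := by
  rw [Finset.sum_ite, Finset.sum_const_zero, zero_add, Finset.sum_subtype _ (p := fun x : F => x ≠ 0) (by simp)]
  exact Fintype.sum_equiv unitsEquivNeZero _ _ fun u => rfl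

theorem kloosterman_eq_sum_ite (ψ : AddChar F ℂ) (a : Fˣ) :
    kloosterman ψ a = ∑ x : F, if x = 0 then 0 else ψ (x + a * x⁻¹) := by
  rw [kloosterman, ← sum_units_eq_sum_ite fun x => ψ (x + a * x⁻¹)]

theorem sum_generalLinearGroup_eq_sum_ite {ι : Type*} [Fintype ι] [DecidableEq ι]
    (f : Matrix ι ι F → ℂ) :
    ∑ w : GL ι F, f w = ∑ M : Matrix ι ι F, if M.det = 0 then 0 else f M := by
  rw [Finset.sum_ite, Finset.sum_const_zero, zero_add]
  refine Finset.sum_bij (fun w _ => (w : Matrix ι ι F)) ?_ ?_ ?_ ?_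
  · intro w _
    simpa using ((Matrix.isUnit_iff_isUnit_det _).1 w.isUnit).ne_zero
  · intro w _ w' _ h
    exact Units.ext h
  · intro M hM
    exact ⟨Matrix.GeneralLinearGroup.mkOfDetNeZero M (by simpa using hM), Finset.mem_univ _, rfl⟩
  · intro w _
    rfl

theorem sum_sum_mul_eq (g : F → ℂ) :
    ∑ b : F, ∑ c : F, g (b * c) =
      ((Fintype.card F : ℂ) - 1) * ∑ x, g x + Fintype.card F * g 0 := by
  rw [← Finset.add_sum_erase _ _ (Finset.mem_univ (0 : F))]
  have h : ∀ b ∈ Finset.univ.erase (0 : F), ∑ c : F, g (b * c) = ∑ x, g x := fun b hb =>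
    Fintype.sum_equiv (Equiv.mulLeft₀ b (by simpa using hb)) _ _ fun c => rfl
  rw [Finset.sum_congr rfl h, Finset.sum_const, Finset.card_erase_of_mem (Finset.mem_univ _),
    nsmul_eq_mul, Nat.cast_sub (Finset.one_le_card.2 Finset.univ_nonempty), Finset.card_univ]
  simp
  ring

theorem multiKloosterman_two (ψ : AddChar F ℂ) (a : Fˣ) :
    multiKloosterman 2 ψ a = ∑ x : F, ∑ y : F,
      if x = 0 then 0 else if y = 0 then 0 else ψ (x + y + a * (x⁻¹ * y⁻¹)) := by
  rw [multiKloosterman]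
  simp only [Fin.sum_univ_two, Fin.prod_univ_two]
  rw [← (finTwoArrowEquiv Fˣ).symm.sum_comp, Fintype.sum_prod_type]
  simp only [finTwoArrowEquiv_symm_apply, Matrix.cons_val_zero, Matrix.cons_val_one]
  have : ∀ x : F, ∑ y : F, (if x = 0 then (0 : ℂ) else if y = 0 then 0 else
      ψ (x + y + a * (x⁻¹ * y⁻¹))) =
      if x = 0 then 0 else ∑ y : Fˣ, ψ (x + y + a * (x⁻¹ * (y : F)⁻¹)) := by
    intro x
    rw [sum_units_eq_sum_ite fun y => ψ (x + y + a * (x⁻¹ * y⁻¹))]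
    split_ifs <;> simp
  simp_rw [this]
  rw [← sum_units_eq_sum_ite fun x => ∑ y : Fˣ, ψ (x + y + a * (x⁻¹ * (y : F)⁻¹))]

theorem kloostermanGL_one (ψ : AddChar F ℂ) (a : Fˣ) :
    kloostermanGL 1 ψ a = kloosterman ψ a := by
  rw [kloostermanGL, kloosterman_eq_sum_ite]
  simp_rw [Matrix.coe_units_inv]
  rw [sum_generalLinearGroup_eq_sum_ite fun M => ψ (M.trace + a * M⁻¹.trace)]
  refine Fintype.sum_equiv Matrix.uniqueEquiv _ _ fun M => ?_
  simp [Matrix.trace]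

/-- The summand depends only on trace and determinant, because `Tr M⁻¹ = Tr M / det M`. With the
diagonal `a, d` fixed, `det = ad - bc`, so the sum over `b, c` is `q - 1` times the sum over all
determinants plus `q` times the term `bc = 0`. -/
theorem kloostermanGL_two (ψ : AddChar F ℂ) (hψ : ψ ≠ 1) :
    kloostermanGL 2 ψ 1 = Fintype.card F *
      (kloosterman ψ 1 ^ 2 + (Fintype.card F : ℂ) ^ 2 - Fintype.card F) := by
  have hp := AddChar.IsPrimitive.of_ne_one hψ
  rw [kloostermanGL]
  simp_rw [Matrix.coe_units_inv]
  rw [sum_generalLinearGroup_eq_sum_ite fun M => ψ (M.trace + ((1 : Fˣ) : F) * M⁻¹.trace)]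
  simp_rw [trace_inv_fin_two]
  rw [sum_matrix_two_eq]
  set g : F → F → ℂ := fun t δ => if δ = 0 then 0 else ψ (t * (1 + δ⁻¹)) with hg
  have h1 : ∀ a d : F, ∑ b, ∑ c, (if (!![a, b; c, d]).det = 0 then 0 else
      ψ ((!![a, b; c, d]).trace + ((1 : Fˣ) : F) *
        ((!![a, b; c, d]).trace * (!![a, b; c, d]).det⁻¹))) =
      ((Fintype.card F : ℂ) - 1) * ∑ δ, g (a + d) δ + Fintype.card F * g (a + d) (a * d) := by
    intro a d
    have h := sum_sum_mul_eq fun x => g (a + d) (a * d - x)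
    rw [sub_zero] at h
    have h' : ∑ x, g (a + d) (a * d - x) = ∑ δ, g (a + d) δ :=
      Fintype.sum_equiv (Equiv.subLeft (a * d)) _ _ fun x => rfl
    rw [← h', ← h]
    simp [hg, Matrix.det_fin_two, Matrix.trace_fin_two, mul_add]
  simp_rw [h1, Finset.sum_add_distrib, ← Finset.mul_sum]
  -- For fixed nonzero `δ` the sum over `a, d` vanishes by orthogonality unless `1 + δ⁻¹ = 0`.
  have h2 : ∑ a, ∑ d, ∑ δ, g (a + d) δ = (Fintype.card F : ℂ) ^ 2 := by
    have : ∀ δ : F, ∑ a, ∑ d, g (a + d) δ =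
        if δ = -1 then (Fintype.card F : ℂ) ^ 2 else 0 := by
      intro δ
      by_cases hδ : δ = 0
      · simp [hg, hδ]
      · have hδ' : 1 + δ⁻¹ = 0 ↔ δ = -1 := by
          constructor
          · intro h
            field_simp at h
            linear_combination h
          · rintro rfl
            simp [inv_neg]
        simp only [hg, hδ, if_false, add_mul, AddChar.map_add_eq_mul, ← Finset.mul_sum,
          ← Finset.sum_mul, AddChar.sum_mulShift _ hp, hδ']
        split_ifs <;> simp [pow_two]
    calc _ = ∑ a, ∑ δ, ∑ d, g (a + d) δ := Finset.sum_congr rfl fun a _ => Finset.sum_comm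
      _ = ∑ δ, ∑ a, ∑ d, g (a + d) δ := Finset.sum_comm
      _ = _ := by simp [this]
  -- The double sum factors, since `(a + d) / (ad) = a⁻¹ + d⁻¹`.
  have h3 : ∑ a, ∑ d, g (a + d) (a * d) = kloosterman ψ 1 ^ 2 := by
    rw [kloosterman_eq_sum_ite, pow_two, Finset.sum_mul_sum]
    refine Finset.sum_congr rfl fun a _ => Finset.sum_congr rfl fun d _ => ?_
    by_cases ha : a = 0
    · simp [hg, ha]
    by_cases hd : d = 0
    · simp [hg, hd]
    simp only [hg, mul_eq_zero, ha, hd, or_self, if_false, ← AddChar.map_add_eq_mul]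
    congr 1
    simp
    field_simp
    ring
  rw [h2, h3]
  ring

end Kloosterman

/-! ### The canonical character in characteristic two. -/

section Canonical

variable {F : Type*} [Field F] [CharP F 2]

theorem canonicalChar_sq [Finite F] (x : F) : canonicalChar F (x ^ 2) = canonicalChar F x := by
  let : Algebra (ZMod 2) F := ZMod.algebra F 2
  have h := Algebra.trace_eq_of_algEquiv (FiniteField.frobeniusAlgEquivOfAlgebraic (ZMod 2) F) x
  simp only [FiniteField.coe_frobeniusAlgEquivOfAlgebraic, ZMod.card] at h
  simp only [canonicalChar, AddChar.compAddMonoidHom_apply]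
  congr 1

theorem canonicalChar_ne_one [Finite F] : canonicalChar F ≠ 1 := by
  let : Algebra (ZMod 2) F := ZMod.algebra F 2
  intro h
  obtain ⟨x, hx⟩ := Algebra.trace_surjective (ZMod 2) F 1
  have h' := DFunLike.congr_fun h x
  have : (canonicalChar F) x = (AddChar.zmodChar 2 (neg_one_sq : (-1 : ℂ) ^ 2 = 1))
    (Algebra.trace (ZMod 2) F x) := rfl
  rw [this, hx, AddChar.zmodChar_apply, AddChar.one_apply] at h'
  norm_num [ZMod.val_one] at h'

theorem canonicalChar_isPrimitive [Finite F] : (canonicalChar F).IsPrimitive :=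
  AddChar.IsPrimitive.of_ne_one canonicalChar_ne_one

theorem sq_bijective [Finite F] : Function.Bijective fun x : F => x ^ 2 := by
  refine Finite.injective_iff_bijective.1 fun x y h => ?_
  exact CharTwo.sq_injective h

variable [Fintype F] [DecidableEq F]

/-- Detect the equation by orthogonality, with `b²` in place of `b`. Since `λ(b²z²) = λ(bz)`, the
exponent becomes linear in `z` with coefficient `b² + b`, so only `b = 0` and `b = 1` survive; they
contribute `1` and `λ(c)`. -/
theorem card_artinSchreier (c : F) :
    ∑ z : F, (if z ^ 2 + z = c then (1 : ℂ) else 0) = 1 + canonicalChar F c := by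
  have hp := canonicalChar_isPrimitive (F := F)
  have hq : (Fintype.card F : ℂ) ≠ 0 := by simp
  apply mul_left_cancel₀ hq
  have key : ∀ z : F, (Fintype.card F : ℂ) * (if z ^ 2 + z = c then (1 : ℂ) else 0) =
      ∑ b : F, canonicalChar F (b ^ 2 * (z ^ 2 + z + c)) := by
    intro z
    rw [sq_bijective.sum_comp fun b => canonicalChar F (b * (z ^ 2 + z + c)),
      AddChar.sum_mulShift _ hp]
    simp [← CharTwo.sub_eq_add (z ^ 2 + z), sub_eq_zero]
  rw [Finset.mul_sum]
  simp_rw [key]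
  rw [Finset.sum_comm]
  have inner : ∀ b : F, ∑ z : F, canonicalChar F (b ^ 2 * (z ^ 2 + z + c)) =
      canonicalChar F (b ^ 2 * c) * (if b * (b + 1) = 0 then (Fintype.card F : ℂ) else 0) := by
    intro b
    have : ∀ z : F, canonicalChar F (b ^ 2 * (z ^ 2 + z + c)) =
        canonicalChar F (b ^ 2 * c) * canonicalChar F (z * (b * (b + 1))) := by
      intro z
      rw [show b ^ 2 * (z ^ 2 + z + c) = (b * z) ^ 2 + b ^ 2 * z + b ^ 2 * c by ring,
        AddChar.map_add_eq_mul, AddChar.map_add_eq_mul, canonicalChar_sq,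
        ← AddChar.map_add_eq_mul, mul_comm]
      congr 2
      ring
    simp_rw [this]
    rw [← Finset.mul_sum, AddChar.sum_mulShift _ hp]
    push_cast
    rfl
  simp_rw [inner]
  have h01 : ∀ b : F, b * (b + 1) = 0 ↔ b = 0 ∨ b = 1 := by
    intro b
    rw [mul_eq_zero, ← CharTwo.sub_eq_add, sub_eq_zero]
  rw [← Finset.sum_subset (Finset.subset_univ {0, 1}) (by
    intro b _ hb
    simp only [Finset.mem_insert, Finset.mem_singleton] at hb
    rw [if_neg (by rwa [h01]), mul_zero]), Finset.sum_pair zero_ne_one]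
  simp [CharTwo.add_self_eq_zero]
  ring

/-- For `t ≠ 0`, putting `x = tz` gives the Artin–Schreier equation `z² + z = d / t²`. For `t = 0`
the equation is `x² = d`, and squaring is bijective. -/
theorem sum_quadratic_eq (t d : F) :
    ∑ x : F, (if x * (t - x) = d then (1 : ℂ) else 0) =
      if t = 0 then 1 else 1 + canonicalChar F (d * (t ^ 2)⁻¹) := by
  split_ifs with ht
  · subst ht
    have : ∀ x : F, x * (0 - x) = x ^ 2 := fun x => by
      rw [zero_sub, CharTwo.neg_eq]; ring
    simp_rw [this]
    rw [sq_bijective.sum_comp fun y => if y = d then (1 : ℂ) else 0]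
    simp
  · rw [← card_artinSchreier, ← Fintype.sum_equiv (Equiv.mulLeft₀ t ht) _ _ fun x => rfl]
    refine Finset.sum_congr rfl fun z _ => ?_
    congr 1
    simp only [Equiv.mulLeft₀_apply, eq_iff_iff, CharTwo.sub_eq_add]
    rw [eq_mul_inv_iff_mul_eq₀ (pow_ne_zero 2 ht)]
    rw [show (z ^ 2 + z) * t ^ 2 = t * z * (t + t * z) by ring]

/-- Group the pairs `(x, y)` in `K²` by `t = x + y` and `d = xy`. In the number of such pairs, the
constant 1 contributes `q`, coming from `d = a`, and the character term contributes `K₂`. -/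
theorem kloosterman_sq_eq (a : Fˣ) :
    kloosterman (canonicalChar F) a ^ 2 =
      multiKloosterman 2 (canonicalChar F) a + Fintype.card F := by
  have hp := canonicalChar_isPrimitive (F := F)
  set ψ := canonicalChar F
  have ha : (a : F) ≠ 0 := a.ne_zero
  have h1 : kloosterman ψ a ^ 2 = ∑ t : F, ∑ d : F, (if d = 0 then 0 else
      ψ (t * (1 + a * d⁻¹)) * ∑ x : F, (if x * (t - x) = d then (1 : ℂ) else 0)) := by
    rw [kloosterman_eq_sum_ite, pow_two, Finset.sum_mul_sum]
    have e : ∀ x : F, ∑ y : F, ((if x = 0 then 0 else ψ (x + a * x⁻¹)) *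
        (if y = 0 then 0 else ψ (y + a * y⁻¹))) =
        ∑ t : F, if x * (t - x) = 0 then 0 else ψ (t * (1 + a * (x * (t - x))⁻¹)) := by
      intro x
      refine Fintype.sum_equiv (Equiv.addRight x) _ _ fun y => ?_
      by_cases hx : x = 0
      · simp [hx]
      by_cases hy : y = 0
      · simp [hy]
      simp only [hx, hy, if_false, Equiv.coe_addRight, add_sub_cancel_right, mul_eq_zero, or_self,
        ← AddChar.map_add_eq_mul]
      congr 1
      field_simp
      ring
    simp_rw [e]
    rw [Finset.sum_comm]
    refine Finset.sum_congr rfl fun t _ => ?_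
    simp_rw [Finset.mul_sum, mul_ite, mul_one, mul_zero]
    have e2 : ∀ d : F, (if d = 0 then (0 : ℂ) else ∑ x : F, if x * (t - x) = d then
        ψ (t * (1 + a * d⁻¹)) else 0) = ∑ x : F, if x * (t - x) = d then
          (if d = 0 then 0 else ψ (t * (1 + a * d⁻¹))) else 0 := by
      intro d
      split_ifs <;> simp
    simp_rw [e2]
    rw [Finset.sum_comm]
    simp
  have h2 : ∀ t d : F, (if d = 0 then 0 else
      ψ (t * (1 + a * d⁻¹)) * ∑ x : F, (if x * (t - x) = d then (1 : ℂ) else 0)) =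
      (if d = 0 then 0 else ψ (t * (1 + a * d⁻¹))) +
      (if t = 0 then 0 else if d = 0 then 0 else ψ (t * (1 + a * d⁻¹) + d * (t ^ 2)⁻¹)) := by
    intro t d
    rw [sum_quadratic_eq]
    split_ifs <;> simp [mul_add, AddChar.map_add_eq_mul, ψ]
  rw [h1]
  simp_rw [h2, Finset.sum_add_distrib]
  rw [add_comm]
  congr 1
  · rw [multiKloosterman_two]
    refine Finset.sum_congr rfl fun t _ => ?_
    by_cases ht : t = 0
    · simp [ht]
    simp only [ht, if_false]
    -- The second Kloosterman variable is `y = ta/d`, for which `a / (ty) = d / t²`.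
    refine Fintype.sum_equiv ((Equiv.inv F).trans (Equiv.mulLeft₀ (t * a) (mul_ne_zero ht ha)))
      _ _ fun d => ?_
    by_cases hd : d = 0
    · simp [hd]
    simp only [hd, if_false, Equiv.trans_apply, Equiv.inv_apply, Equiv.mulLeft₀_apply,
      mul_eq_zero, ht, ha, inv_eq_zero, or_self]
    congr 1
    field_simp
  · rw [Finset.sum_comm]
    have : ∀ d : F, ∑ t : F, (if d = 0 then 0 else ψ (t * (1 + a * d⁻¹))) =
        if d = a then (Fintype.card F : ℂ) else 0 := by
      intro d
      by_cases hd : d = 0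
      · simp [hd, ha.symm]
      simp only [hd, if_false]
      rw [AddChar.sum_mulShift _ hp]
      have : 1 + a * d⁻¹ = 0 ↔ d = a := by
        rw [← CharTwo.sub_eq_add, sub_eq_zero, eq_mul_inv_iff_mul_eq₀ hd, one_mul]
      simp [this]
    simp [this]

/-- Substitute `x = a⁻¹y²`: then `a(x + x⁻¹) = (y + a/y)²`, and `λ` does not see the square. -/
theorem kloosterman_mulShift (a : Fˣ) :
    kloosterman ((canonicalChar F).mulShift (a : F)) 1 = kloosterman (canonicalChar F) a := by
  have ha : (a : F) ≠ 0 := a.ne_zero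
  rw [kloosterman_eq_sum_ite, kloosterman_eq_sum_ite]
  symm
  refine Fintype.sum_equiv ((Equiv.ofBijective _ sq_bijective).trans
    (Equiv.mulLeft₀ (a : F)⁻¹ (inv_ne_zero ha))) _ _ fun y => ?_
  by_cases hy : y = 0
  · simp [hy]
  simp only [hy, if_false, Equiv.trans_apply, Equiv.ofBijective_apply, Equiv.mulLeft₀_apply,
    mul_eq_zero, inv_eq_zero, ha, pow_eq_zero_iff two_ne_zero, or_self, AddChar.mulShift_apply]
  rw [← canonicalChar_sq, CharTwo.add_sq]
  congr 1
  simp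
  field_simp

end Canonical

/-! ### Counting invertible alternating matrices. -/

section Alternating

variable {F : Type*} [Field F] {ι κ : Type*} [Fintype ι] [Fintype κ]

theorem trace_submatrix_equiv (M : Matrix ι ι F) (e : κ ≃ ι) :
    (M.submatrix e e).trace = M.trace :=
  e.sum_comp fun i => M i i

theorem trace_fromBlocks_add (X : Matrix ι ι F) (Y : Matrix ι κ F) (Z : Matrix κ ι F)
    (W : Matrix κ κ F) : (Matrix.fromBlocks X Y Z W).trace = X.trace + W.trace := by
  simp [Matrix.trace, Fintype.sum_sum_type]

/-- Matrices orthogonal to all symmetric matrices under the trace pairing; these are the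
alternating matrices. -/
def IsAlternatingMatrix (M : Matrix ι ι F) : Prop :=
  ∀ B : Matrix ι ι F, B.IsSymm → (M * B).trace = 0

theorem isAlternatingMatrix_zero : IsAlternatingMatrix (0 : Matrix ι ι F) := fun B _ => by simp

theorem isAlternatingMatrix_fromBlocks {X : Matrix ι ι F} {Y : Matrix ι κ F} {Z : Matrix κ ι F}
    {W : Matrix κ κ F} : IsAlternatingMatrix (Matrix.fromBlocks X Y Z W) ↔
      IsAlternatingMatrix X ∧ Z = -Yᵀ ∧ IsAlternatingMatrix W := by
  have htr : ∀ (A : Matrix ι ι F) (B : Matrix ι κ F) (C : Matrix κ ι F) (D : Matrix κ κ F),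
      (Matrix.fromBlocks X Y Z W * Matrix.fromBlocks A B C D).trace =
        (X * A).trace + (Y * C).trace + ((Z * B).trace + (W * D).trace) := by
    intro A B C D
    rw [Matrix.fromBlocks_multiply, trace_fromBlocks_add, Matrix.trace_add, Matrix.trace_add]
  constructor
  · intro h
    refine ⟨fun B hB => ?_, ?_, fun B hB => ?_⟩
    · have := h (Matrix.fromBlocks B 0 0 0)
        (Matrix.IsSymm.fromBlocks hB (by simp) (Matrix.isSymm_zero))
      rw [htr] at this
      simpa using this
    · rw [eq_neg_iff_add_eq_zero, Matrix.ext_iff_trace_mul_right]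
      intro B
      have := h (Matrix.fromBlocks 0 B Bᵀ 0)
        (Matrix.IsSymm.fromBlocks Matrix.isSymm_zero rfl Matrix.isSymm_zero)
      rw [htr, ← Matrix.trace_transpose (Y * Bᵀ), Matrix.transpose_mul, Matrix.transpose_transpose,
        Matrix.trace_mul_comm B] at this
      rw [Matrix.add_mul, Matrix.trace_add]
      simpa [add_comm] using this
    · have := h (Matrix.fromBlocks 0 0 0 B)
        (Matrix.IsSymm.fromBlocks Matrix.isSymm_zero (by simp) hB)
      rw [htr] at this
      simpa using this
  · rintro ⟨hX, rfl, hW⟩ B hB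
    rw [← Matrix.fromBlocks_toBlocks B] at hB ⊢
    obtain ⟨h1, h2, -, h4⟩ := Matrix.isSymm_fromBlocks_iff.1 hB
    rw [htr, hX _ h1, hW _ h4, ← h2, ← Matrix.trace_transpose (Y * _), Matrix.transpose_mul,
      Matrix.transpose_transpose, Matrix.trace_mul_comm]
    simp

theorem IsAlternatingMatrix.congruence {M : Matrix ι ι F} (hM : IsAlternatingMatrix M)
    (g : Matrix ι κ F) : IsAlternatingMatrix (gᵀ * M * g) := by
  intro B hB
  rw [Matrix.mul_assoc, Matrix.trace_mul_comm, ← Matrix.mul_assoc, Matrix.trace_mul_comm]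
  refine hM _ ?_
  rw [Matrix.IsSymm, Matrix.transpose_mul, Matrix.transpose_mul, hB.eq, Matrix.transpose_transpose,
    Matrix.mul_assoc]

theorem IsAlternatingMatrix.submatrix {M : Matrix ι ι F} (hM : IsAlternatingMatrix M)
    (e : κ ≃ ι) : IsAlternatingMatrix (M.submatrix e e) := by
  intro B hB
  have : M.submatrix e e * B = (M * B.submatrix e.symm e.symm).submatrix e e := by
    rw [Matrix.submatrix_mul_equiv M _ e e e |>.symm]
    simp
  rw [this, trace_submatrix_equiv]
  exact hM _ (hB.submatrix _)

theorem isAlternatingMatrix_unit {M : Matrix Unit Unit F} : IsAlternatingMatrix M ↔ M = 0 := by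
  refine ⟨fun h => ?_, fun h => h ▸ isAlternatingMatrix_zero⟩
  ext i j
  simpa [Matrix.trace] using h 1 Matrix.isSymm_one

theorem IsAlternatingMatrix.eq_bordered {M : Matrix (Unit ⊕ κ) (Unit ⊕ κ) F}
    (hM : IsAlternatingMatrix M) :
    M = Matrix.fromBlocks 0 M.toBlocks₁₂ (-M.toBlocks₁₂ᵀ) M.toBlocks₂₂ := by
  rw [← Matrix.fromBlocks_toBlocks M] at hM
  obtain ⟨h1, h2, -⟩ := isAlternatingMatrix_fromBlocks.1 hM
  rw [isAlternatingMatrix_unit] at h1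
  conv_lhs => rw [← Matrix.fromBlocks_toBlocks M, h1, h2]

theorem IsAlternatingMatrix.toBlocks₂₂ {M : Matrix (ι ⊕ κ) (ι ⊕ κ) F}
    (hM : IsAlternatingMatrix M) : IsAlternatingMatrix M.toBlocks₂₂ := by
  rw [← Matrix.fromBlocks_toBlocks M] at hM
  exact (isAlternatingMatrix_fromBlocks.1 hM).2.2

variable [DecidableEq ι] [DecidableEq κ]

variable (F ι) in
/-- The number of invertible alternating matrices. -/
noncomputable def invertibleAlternatingCard : ℕ :=
  Nat.card {M : Matrix ι ι F // IsAlternatingMatrix M ∧ M.det ≠ 0}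

theorem invertibleAlternatingCard_congr (e : ι ≃ κ) :
    invertibleAlternatingCard F ι = invertibleAlternatingCard F κ := by
  refine Nat.card_congr ((Matrix.reindex e e).subtypeEquiv fun M => ?_)
  rw [Matrix.det_reindex_self]
  refine and_congr_left fun _ => ⟨fun h => h.submatrix e.symm, fun h => ?_⟩
  simpa using h.submatrix e

theorem invertibleAlternatingCard_of_isEmpty [IsEmpty ι] : invertibleAlternatingCard F ι = 1 := by
  rw [invertibleAlternatingCard, Nat.card_eq_one_iff_unique]
  exact ⟨inferInstance, ⟨⟨0, isAlternatingMatrix_zero, by simp⟩⟩⟩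

/-- Transitivity of the general linear group on nonzero vectors makes the bordered count independent
of the nonzero first row. -/
theorem exists_vecMul_eq {x y : κ → F} (hx : x ≠ 0) (hy : y ≠ 0) :
    ∃ g : Matrix κ κ F, g.det ≠ 0 ∧ x ᵥ* g = y := by
  obtain ⟨G, hG, hG'⟩ : ∃ G : κ → F, x ⬝ᵥ G = 1 ∧ y ⬝ᵥ G ≠ 0 := by
    obtain ⟨i, hi⟩ := Function.ne_iff.1 hx
    obtain ⟨j, hj⟩ := Function.ne_iff.1 hy
    simp only [Pi.zero_apply] at hi hj
    by_cases hyi : y i = 0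
    · by_cases hxj : x j = 0
      · refine ⟨Pi.single i (x i)⁻¹ + Pi.single j 1, ?_, ?_⟩
        · simp [dotProduct_add, hi, hxj]
        · simp [dotProduct_add, hyi, hj]
      · exact ⟨Pi.single j (x j)⁻¹, by simp [hxj], by simp [hxj, hj]⟩
    · exact ⟨Pi.single i (x i)⁻¹, by simp [hi], by simp [hi, hyi]⟩
  -- A rank-one perturbation: `x` goes to `x + (x·G)(y - x) = y`, and the determinant is `1 + (y -
  -- x)·G = y·G`.
  refine ⟨1 + Matrix.replicateCol Unit G * Matrix.replicateRow Unit (y - x), ?_, ?_⟩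
  · rw [Matrix.det_one_add_replicateCol_mul_replicateRow, sub_dotProduct, hG]
    simpa using hG'
  · rw [Matrix.vecMul_add, Matrix.vecMul_one, ← Matrix.vecMul_vecMul]
    ext k
    have : x ᵥ* Matrix.replicateCol Unit G = fun _ => 1 := by
      ext u
      exact hG
    rw [this]
    simp [Matrix.vecMul, dotProduct]

variable (F) in
/-- The number of invertible alternating matrices with prescribed first row `(0, v)`. -/
noncomputable def borderedCard (v : κ → F) : ℕ :=
  Nat.card {M : Matrix κ κ F // IsAlternatingMatrix M ∧
    (Matrix.fromBlocks (0 : Matrix Unit Unit F) (Matrix.replicateRow Unit v)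
      (-(Matrix.replicateRow Unit v)ᵀ) M).det ≠ 0}

theorem borderedCard_zero : borderedCard F (0 : κ → F) = 0 := by
  rw [borderedCard, Nat.card_eq_zero]
  left
  rw [isEmpty_subtype]
  rintro M ⟨-, h⟩
  apply h
  apply Matrix.det_eq_zero_of_row_eq_zero (Sum.inl ())
  rintro (j | j) <;> simp

/-- Congruence by `1 ⊕ g` with `vg = w` carries the first row `(0, v)` to `(0, w)`. Exchanging `v`
and `w` turns the inequality into equality. -/
theorem borderedCard_le [Finite F] {v w : κ → F} (hv : v ≠ 0) (hw : w ≠ 0) :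
    borderedCard F v ≤ borderedCard F w := by
  obtain ⟨g, hg, hgv⟩ := exists_vecMul_eq hv hw
  have hrow : Matrix.replicateRow Unit v * g = Matrix.replicateRow Unit w := by
    rw [← hgv, Matrix.replicateRow_vecMul]
  refine Nat.card_le_card_of_injective
    (fun M => ⟨gᵀ * M.1 * g, M.2.1.congruence g, ?_⟩) ?_
  · have : Matrix.fromBlocks (0 : Matrix Unit Unit F) (Matrix.replicateRow Unit w)
        (-(Matrix.replicateRow Unit w)ᵀ) (gᵀ * M.1 * g) =
        Matrix.fromBlocks 1 0 0 gᵀ * Matrix.fromBlocks (0 : Matrix Unit Unit F)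
          (Matrix.replicateRow Unit v) (-(Matrix.replicateRow Unit v)ᵀ) M.1 *
          Matrix.fromBlocks 1 0 0 g := by
      simp only [Matrix.fromBlocks_multiply, ← hrow, Matrix.transpose_mul]
      simp
    rw [this, Matrix.det_mul, Matrix.det_mul]
    refine mul_ne_zero (mul_ne_zero ?_ M.2.2) ?_
    · simpa using hg
    · simpa using hg
  · intro M N h
    have hu : IsUnit g := (Matrix.isUnit_iff_isUnit_det g).2 hg.isUnit
    have hu' : IsUnit gᵀ := (Matrix.isUnit_iff_isUnit_det gᵀ).2 (by simpa using hg)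
    exact Subtype.ext (hu'.mul_left_cancel (hu.mul_right_cancel (Subtype.ext_iff.1 h)))

theorem invertibleAlternatingCard_unit_sum [Fintype F] {e : κ → F} (he : e ≠ 0) :
    invertibleAlternatingCard F (Unit ⊕ κ) =
      (Fintype.card F ^ Fintype.card κ - 1) * borderedCard F e := by
  classical
  have h : invertibleAlternatingCard F (Unit ⊕ κ) = ∑ v : κ → F, borderedCard F v := by
    simp only [borderedCard]
    rw [← Nat.card_sigma]
    refine Nat.card_congr ⟨fun M => ⟨fun k => M.1 (Sum.inl ()) (Sum.inr k), M.1.toBlocks₂₂, ?_⟩,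
      fun p => ⟨Matrix.fromBlocks (0 : Matrix Unit Unit F) (Matrix.replicateRow Unit p.1)
        (-(Matrix.replicateRow Unit p.1)ᵀ) p.2.1, isAlternatingMatrix_fromBlocks.2
          ⟨isAlternatingMatrix_zero, rfl, p.2.2.1⟩, p.2.2.2⟩, fun M => ?_, fun p => ?_⟩
    · have h := M.2.2
      rw [M.2.1.eq_bordered] at h
      exact ⟨M.2.1.toBlocks₂₂, h⟩
    · exact Subtype.ext M.2.1.eq_bordered.symm
    · rfl
  rw [h, ← Finset.add_sum_erase _ _ (Finset.mem_univ 0), borderedCard_zero, zero_add,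
    Finset.sum_congr rfl fun v hv => le_antisymm (borderedCard_le (Finset.ne_of_mem_erase hv) he)
      (borderedCard_le he (Finset.ne_of_mem_erase hv)), Finset.sum_const,
    Finset.card_erase_of_mem (Finset.mem_univ _), Finset.card_univ, Fintype.card_fun, smul_eq_mul]

theorem det_ne_zero_iff_mulVec {M : Matrix ι ι F} :
    M.det ≠ 0 ↔ ∀ x, M *ᵥ x = 0 → x = 0 := by
  rw [Ne, ← Matrix.exists_mulVec_eq_zero_iff]
  push Not
  exact forall_congr' fun x => ⟨fun h hx => by_contra fun h0 => h h0 hx, fun h h0 hx => h0 (h hx)⟩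

/-- Solve for the kernel: on a vector `(a, b, y)` the first row forces `b = 0`, the last block then
says `My = 0`, and the second row determines `a = u·y`. Thus `u` is unconstrained. -/
theorem det_bordered_ne_zero_iff (u : Matrix Unit ι F) (M : Matrix ι ι F) :
    (Matrix.fromBlocks (0 : Matrix Unit Unit F)
      (Matrix.replicateRow Unit (Sum.elim (fun _ : Unit => 1) fun _ : ι => 0))
      (-(Matrix.replicateRow Unit (Sum.elim (fun _ : Unit => 1) fun _ : ι => 0))ᵀ)
      (Matrix.fromBlocks (0 : Matrix Unit Unit F) u (-uᵀ) M)).det ≠ 0 ↔ M.det ≠ 0 := by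
  have key : ∀ (a b : F) (y : ι → F), Matrix.fromBlocks (0 : Matrix Unit Unit F)
      (Matrix.replicateRow Unit (Sum.elim (fun _ : Unit => 1) fun _ : ι => 0))
      (-(Matrix.replicateRow Unit (Sum.elim (fun _ : Unit => 1) fun _ : ι => 0))ᵀ)
      (Matrix.fromBlocks (0 : Matrix Unit Unit F) u (-uᵀ) M) *ᵥ
        Sum.elim (fun _ => a) (Sum.elim (fun _ => b) y) =
      Sum.elim (fun _ => b) (Sum.elim (fun _ => -a + u () ⬝ᵥ y) (-(b • u ()) + M *ᵥ y)) := by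
    intro a b y
    ext (i | i | i)
    · simp [Matrix.mulVec, dotProduct]
    · simp [Matrix.mulVec, dotProduct]
    · simp [Matrix.mulVec, dotProduct, mul_comm]
  rw [det_ne_zero_iff_mulVec, det_ne_zero_iff_mulVec]
  constructor
  · intro h y hy
    have := h (Sum.elim (fun _ => u () ⬝ᵥ y) (Sum.elim (fun _ => 0) y)) (by
      rw [key, hy]
      ext (i | i | i) <;> simp)
    ext i
    exact congrFun this (Sum.inr (Sum.inr i))
  · intro h x hx
    obtain ⟨a, b, y, rfl⟩ : ∃ a b y, x = Sum.elim (fun _ => a) (Sum.elim (fun _ => b) y) :=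
      ⟨x (Sum.inl ()), x (Sum.inr (Sum.inl ())), fun i => x (Sum.inr (Sum.inr i)), by
        ext (i | i | i) <;> rfl⟩
    rw [key] at hx
    obtain rfl : b = 0 := congrFun hx (Sum.inl ())
    have hy : y = 0 := h y (by
      ext i
      simpa using congrFun hx (Sum.inr (Sum.inr i)))
    have ha : a = 0 := by simpa [hy] using congrFun hx (Sum.inr (Sum.inl ()))
    rw [ha, hy]
    ext (i | i | i) <;> rfl

theorem borderedCard_single [Fintype F] :
    borderedCard F (Sum.elim (fun _ : Unit => 1) fun _ : ι => 0) =
      Fintype.card F ^ Fintype.card ι * invertibleAlternatingCard F ι := by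
  have : Fintype.card F ^ Fintype.card ι = Nat.card (Matrix Unit ι F) := by
    simp [Matrix]
  rw [this, invertibleAlternatingCard, ← Nat.card_prod]
  refine Nat.card_congr ⟨fun M => ⟨M.1.toBlocks₁₂, M.1.toBlocks₂₂, ?_⟩,
    fun p => ⟨Matrix.fromBlocks (0 : Matrix Unit Unit F) p.1 (-p.1ᵀ) p.2.1,
      isAlternatingMatrix_fromBlocks.2 ⟨isAlternatingMatrix_zero, rfl, p.2.2.1⟩,
      (det_bordered_ne_zero_iff _ _).2 p.2.2.2⟩, fun M => ?_, fun p => rfl⟩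
  · have h := M.2.2
    rw [M.2.1.eq_bordered, det_bordered_ne_zero_iff] at h
    exact ⟨M.2.1.toBlocks₂₂, h⟩
  · exact Subtype.ext M.2.1.eq_bordered.symm

/-- The recursion is `N(2l + 2) = (q^(2l+1) - 1) q^(2l) N(2l)`: choose a nonzero first row, then the
free row `u`, then the remaining block. -/
theorem invertibleAlternatingCard_fin_even [Fintype F] (l : ℕ) :
    (invertibleAlternatingCard F (Fin (2 * l)) : ℂ) = (Fintype.card F : ℂ) ^ (l * (l - 1)) *
      ∏ j ∈ Finset.Icc 1 l, ((Fintype.card F : ℂ) ^ (2 * j - 1) - 1) := by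
  induction l with
  | zero => simp [invertibleAlternatingCard_of_isEmpty (F := F) (ι := Fin 0)]
  | succ l ih =>
    have e : Fin (2 * (l + 1)) ≃ Unit ⊕ (Unit ⊕ Fin (2 * l)) :=
      Fintype.equivOfCardEq (by simp; ring)
    rw [invertibleAlternatingCard_congr e, invertibleAlternatingCard_unit_sum
      (F := F)
      (e := Sum.elim (fun _ : Unit => 1) fun _ : Fin (2 * l) => 0)
      (fun h => one_ne_zero (congrFun h (Sum.inl ()))), borderedCard_single,
      Finset.prod_Icc_succ_top (by omega)]
    have h1 : 1 ≤ Fintype.card F ^ (2 * l + 1) := Nat.one_le_pow _ _ Fintype.card_pos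
    rw [Fintype.card_sum, Fintype.card_unit, Fintype.card_fin, add_comm 1, Nat.cast_mul,
      Nat.cast_mul, ih, Nat.cast_sub h1]
    have h2 : (l + 1) * (l + 1 - 1) = 2 * l + l * (l - 1) := by
      cases l with
      | zero => rfl
      | succ l => simp; ring
    rw [h2, show 2 * (l + 1) - 1 = 2 * l + 1 by omega]
    push_cast
    ring

end Alternating

/-! ### Class functions summed over a double coset. -/

section DoubleCosetSum

variable {G : Type*} [Group G]

/-- Sum `f(xgy)` over `H × H` in two ways: the map to `HgH` has all fibres of size `|H ∩ gHg⁻¹|`,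
and `f(xgy) = f(yxg)` makes the sum over `x` independent of `y`. -/
theorem card_mul_sum_doubleCoset (H : Subgroup G) [Fintype H] (g : G) (f : G → ℂ)
    (hf : ∀ x y, f (x * y) = f (y * x)) (S : Finset G)
    (hS : ∀ w, w ∈ S ↔ w ∈ DoubleCoset.doubleCoset g (H : Set G) H) :
    (Nat.card {h : H // g⁻¹ * h * g ∈ H} : ℂ) * ∑ w ∈ S, f w =
      Fintype.card H * ∑ h : H, f (h * g) := by
  classical
  trans ∑ p : H × H, f (p.1 * g * p.2)
  · rw [← Finset.sum_fiberwise_of_maps_to (s := Finset.univ) (t := S)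
      (g := fun p : H × H => (p.1 * g * p.2 : G)) (by
        intro p _
        rw [hS, DoubleCoset.mem_doubleCoset]
        exact ⟨p.1, p.1.2, p.2, p.2.2, rfl⟩), Finset.mul_sum]
    refine Finset.sum_congr rfl fun w hw => ?_
    rw [Finset.sum_congr rfl (g := fun _ => f w) (fun p hp => by
      rw [(Finset.mem_filter.1 hp).2]), Finset.sum_const, nsmul_eq_mul]
    congr 2
    rw [hS, DoubleCoset.mem_doubleCoset] at hw
    obtain ⟨x, hx, y, hy, rfl⟩ := hw
    rw [← Fintype.card_subtype, ← Nat.card_eq_fintype_card]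
    -- The fibre over `xgy` consists of the pairs `(xh, (g⁻¹hg)⁻¹y)`.
    refine Nat.card_congr ⟨fun h => ⟨(⟨x, hx⟩ * h.1, ⟨g⁻¹ * h.1 * g, h.2⟩⁻¹ * ⟨y, hy⟩), ?_⟩,
      fun p => ⟨⟨x, hx⟩⁻¹ * p.1.1, ?_⟩, fun h => ?_, fun p => ?_⟩
    · simp only [Subgroup.coe_mul, Subgroup.coe_inv]
      group
    · have hp : (p.1.1 * g * p.1.2 : G) = x * g * y := p.2
      have : g⁻¹ * (x⁻¹ * p.1.1) * g = y * (p.1.2 : G)⁻¹ := by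
        rw [eq_mul_inv_iff_mul_eq]
        calc _ = g⁻¹ * x⁻¹ * (p.1.1 * g * p.1.2 : G) := by group
          _ = y := by rw [hp]; group
      simp only [Subgroup.coe_mul, Subgroup.coe_inv]
      rw [this]
      exact H.mul_mem hy (H.inv_mem p.1.2.2)
    · ext
      simp
    · have hp : (p.1.1 * g * p.1.2 : G) = x * g * y := p.2
      ext
      · simp
      · simp only [Subgroup.coe_mul, Subgroup.coe_inv]
        calc _ = (p.1.1 * g : G)⁻¹ * (x * g * y) := by group
          _ = _ := (eq_inv_mul_of_mul_eq hp).symm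
  · rw [Fintype.sum_prod_type, Finset.sum_comm]
    have : ∀ y : H, ∑ x : H, f (x * g * y) = ∑ h : H, f (h * g) := by
      intro y
      refine Fintype.sum_equiv (Equiv.mulLeft y) _ _ fun x => ?_
      rw [hf]
      simp [mul_assoc]
    simp [this]

end DoubleCosetSum

/-! ### Block lower triangular invertible matrices. -/

section BlockTriangular

variable {F : Type*} [Field F] {ι κ : Type*} [Fintype ι] [Fintype κ] [DecidableEq ι]
  [DecidableEq κ]

/-- The invertible block lower triangular matrix `[[X, 0], [Z, Y]]`. -/
def blockLower (X : GL ι F) (Y : GL κ F) (Z : Matrix κ ι F) : GL (ι ⊕ κ) F where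
  val := Matrix.fromBlocks X 0 Z Y
  inv := Matrix.fromBlocks (X⁻¹ : GL ι F) 0
    (-(((Y⁻¹ : GL κ F) : Matrix κ κ F) * Z * ((X⁻¹ : GL ι F) : Matrix ι ι F))) (Y⁻¹ : GL κ F)
  val_inv := by
    rw [Matrix.fromBlocks_multiply, ← Matrix.fromBlocks_one]
    congr 1
    · simp
    · simp
    · rw [Matrix.mul_neg, ← Matrix.mul_assoc, ← Matrix.mul_assoc, Units.mul_inv, Matrix.one_mul,
        add_neg_cancel]
    · simp
  inv_val := by
    rw [Matrix.fromBlocks_multiply, ← Matrix.fromBlocks_one]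
    congr 1
    · simp
    · simp
    · rw [Matrix.neg_mul, Matrix.mul_assoc _ _ (X : Matrix ι ι F), Units.inv_mul, Matrix.mul_one,
        neg_add_cancel]
    · simp

/-- Invertible matrices with vanishing upper right block, described by their blocks. -/
noncomputable def blockLowerEquiv :
    (GL ι F × GL κ F × Matrix κ ι F) ≃
      {A : GL (ι ⊕ κ) F // (A : Matrix (ι ⊕ κ) (ι ⊕ κ) F).toBlocks₁₂ = 0} :=
  Equiv.ofBijective (fun p => ⟨blockLower p.1 p.2.1 p.2.2, rfl⟩) <| by
    constructor
    · rintro ⟨X, Y, Z⟩ ⟨X', Y', Z'⟩ h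
      have h' : Matrix.fromBlocks (X : Matrix ι ι F) 0 Z (Y : Matrix κ κ F) =
          Matrix.fromBlocks (X' : Matrix ι ι F) 0 Z' (Y' : Matrix κ κ F) :=
        congrArg Units.val (Subtype.ext_iff.1 h)
      obtain ⟨h1, -, h3, h4⟩ := Matrix.fromBlocks_inj.1 h'
      rw [Units.ext h1, h3, Units.ext h4]
    · rintro ⟨A, hA⟩
      have hM := (Matrix.fromBlocks_toBlocks (A : Matrix (ι ⊕ κ) (ι ⊕ κ) F)).symm
      rw [hA] at hM
      have hdet := ((Matrix.isUnit_iff_isUnit_det _).1 A.isUnit).ne_zero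
      rw [hM, Matrix.det_fromBlocks_zero₁₂] at hdet
      refine ⟨⟨Matrix.GeneralLinearGroup.mkOfDetNeZero _ (left_ne_zero_of_mul hdet),
        Matrix.GeneralLinearGroup.mkOfDetNeZero _ (right_ne_zero_of_mul hdet),
        (A : Matrix (ι ⊕ κ) (ι ⊕ κ) F).toBlocks₂₁⟩, Subtype.ext (Units.ext ?_)⟩
      exact hM.symm

theorem toBlocks₁₂_inv_eq_zero {A : GL (ι ⊕ κ) F}
    (hA : (A : Matrix (ι ⊕ κ) (ι ⊕ κ) F).toBlocks₁₂ = 0) :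
    ((A⁻¹ : GL (ι ⊕ κ) F) : Matrix (ι ⊕ κ) (ι ⊕ κ) F).toBlocks₁₂ = 0 := by
  obtain ⟨p, hp⟩ := blockLowerEquiv.surjective ⟨A, hA⟩
  obtain rfl : blockLower p.1 p.2.1 p.2.2 = A := Subtype.ext_iff.1 hp
  rfl

theorem isUnit_toBlocks₁₁ {A : GL (ι ⊕ κ) F}
    (hA : (A : Matrix (ι ⊕ κ) (ι ⊕ κ) F).toBlocks₁₂ = 0) :
    IsUnit (A : Matrix (ι ⊕ κ) (ι ⊕ κ) F).toBlocks₁₁ := by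
  obtain ⟨p, hp⟩ := blockLowerEquiv.surjective ⟨A, hA⟩
  obtain rfl : blockLower p.1 p.2.1 p.2.2 = A := Subtype.ext_iff.1 hp
  exact p.1.isUnit

end BlockTriangular

/-! ### Symmetric matrices and character orthogonality. -/

section SymmetricMatrices

variable {F : Type*} {ι κ : Type*}

variable (F ι) in
/-- Symmetric matrices. -/
abbrev SymmMatrix : Type _ := {B : Matrix ι ι F // B.IsSymm}

theorem card_symmMatrix [Fintype F] [Fintype ι] :
    Nat.card (SymmMatrix F ι) = Fintype.card F ^ (Fintype.card ι + 1).choose 2 := by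
  classical
  have e : SymmMatrix F ι ≃ (Sym2 ι → F) :=
    (Equiv.subtypeEquivRight fun B => ⟨fun h i j => h.apply j i, fun h => by
      ext i j; exact h j i⟩).trans Sym2.lift
  rw [Nat.card_congr e, Nat.card_fun, Nat.card_eq_fintype_card, Nat.card_eq_fintype_card, Sym2.card]

theorem card_symmMatrix_fin [Fintype F] (n m : ℕ) (h : 2 * m = n * (n + 1)) :
    (Nat.card (SymmMatrix F (Fin n)) : ℂ) = (Fintype.card F : ℂ) ^ m := by
  rw [card_symmMatrix, Fintype.card_fin, Nat.choose_two_right, Nat.add_sub_cancel,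
    mul_comm (n + 1), ← h, Nat.mul_div_cancel_left _ two_pos, Nat.cast_pow]

variable [Field F]

/-- The block `B₁₁` is free; isolating it exposes the factor that cancels against the stabilizer of
the double coset. -/
theorem card_symmMatrix_sum [Finite F] [Finite ι] [Finite κ] :
    Nat.card (SymmMatrix F (ι ⊕ κ)) = Nat.card (SymmMatrix F ι) *
      Nat.card {B : SymmMatrix F (ι ⊕ κ) // B.1.toBlocks₁₁ = 0} := by
  rw [← Nat.card_prod]
  refine Nat.card_congr ⟨fun B => ⟨⟨B.1.toBlocks₁₁, ?_⟩,
      ⟨⟨Matrix.fromBlocks 0 B.1.toBlocks₁₂ B.1.toBlocks₂₁ B.1.toBlocks₂₂, ?_⟩, rfl⟩⟩,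
    fun p => ⟨Matrix.fromBlocks p.1.1 p.2.1.1.toBlocks₁₂ p.2.1.1.toBlocks₂₁ p.2.1.1.toBlocks₂₂, ?_⟩,
    fun B => ?_, fun p => ?_⟩
  · have h := B.2
    rw [← Matrix.fromBlocks_toBlocks B.1, Matrix.isSymm_fromBlocks_iff] at h
    exact h.1
  · have h := B.2
    rw [← Matrix.fromBlocks_toBlocks B.1, Matrix.isSymm_fromBlocks_iff] at h
    exact Matrix.isSymm_fromBlocks_iff.2 ⟨Matrix.isSymm_zero, h.2⟩
  · have h := p.2.1.2
    rw [← Matrix.fromBlocks_toBlocks p.2.1.1, Matrix.isSymm_fromBlocks_iff] at h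
    exact Matrix.isSymm_fromBlocks_iff.2 ⟨p.1.2, h.2⟩
  · exact Subtype.ext (Matrix.fromBlocks_toBlocks B.1)
  · obtain ⟨X, ⟨B, hB⟩, h⟩ := p
    have hB' : Matrix.fromBlocks 0 B.toBlocks₁₂ B.toBlocks₂₁ B.toBlocks₂₂ = B := by
      conv_rhs => rw [← Matrix.fromBlocks_toBlocks B]
      rw [show B.toBlocks₁₁ = 0 from h]
    exact Prod.ext rfl (Subtype.ext (Subtype.ext hB'))

theorem sum_symmMatrix_addChar [Fintype ι] [Finite F] [Fintype (SymmMatrix F ι)] {ψ : AddChar F ℂ}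
    (hψ : ψ ≠ 1) (M : Matrix ι ι F) [Decidable (IsAlternatingMatrix M)] :
    ∑ B : SymmMatrix F ι, ψ (M * B.1).trace =
      if IsAlternatingMatrix M then (Nat.card (SymmMatrix F ι) : ℂ) else 0 := by
  split_ifs with h
  · rw [Finset.sum_congr rfl fun B _ => by rw [h B.1 B.2, AddChar.map_zero_eq_one]]
    simp [Nat.card_eq_fintype_card]
  · simp only [IsAlternatingMatrix, not_forall] at h
    obtain ⟨B₀, hB₀, h⟩ := h
    obtain ⟨x, hx⟩ : ∃ x, ψ x ≠ 1 := by
      by_contra! hall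
      exact hψ (DFunLike.ext _ _ hall)
    -- `B₀` is rescaled so that its pairing with `M` is `x`; translation by `C` then multiplies the
    -- sum by `ψ x ≠ 1`.
    set C := (x * (M * B₀).trace⁻¹) • B₀ with hC
    have hCs : C.IsSymm := hB₀.smul _
    have htr : (M * C).trace = x := by
      rw [hC, Matrix.mul_smul, Matrix.trace_smul, smul_eq_mul, mul_assoc, inv_mul_cancel₀ h,
        mul_one]
    have : ∑ B : SymmMatrix F ι, ψ (M * B.1).trace =
        ψ x * ∑ B : SymmMatrix F ι, ψ (M * B.1).trace := by
      rw [Finset.mul_sum]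
      symm
      refine Fintype.sum_equiv ⟨fun B => ⟨C + B.1, hCs.add B.2⟩, fun B => ⟨B.1 - C, B.2.sub hCs⟩,
        fun B => by simp, fun B => by simp⟩ _ _ fun B => ?_
      rw [← AddChar.map_add_eq_mul, ← htr, ← Matrix.trace_add, ← Matrix.mul_add]
      rfl
    have h0 : (1 - ψ x) * ∑ B : SymmMatrix F ι, ψ (M * B.1).trace = 0 := by
      linear_combination this
    exact (mul_eq_zero.1 h0).resolve_left (sub_ne_zero.2 (Ne.symm hx))

end SymmetricMatrices

/-! ### The Siegel parabolic and its conjugate by σ. -/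

section Parabolic

variable {F : Type*} [Field F]

/-- For a symplectic `[[A, B], [0, D]]` the defining relations already give `D = ᵗA⁻¹` and make
`A⁻¹B = DᵀB` symmetric. -/
theorem mem_siegelParabolic_iff {n : ℕ} {w : Matrix.symplecticGroup (Fin n) F} :
    w ∈ siegelParabolic n F ↔
      (w : Matrix (Fin n ⊕ Fin n) (Fin n ⊕ Fin n) F).toBlocks₂₁ = 0 := by
  constructor
  · rintro ⟨A, B, -, hw⟩
    rw [hw, Matrix.fromBlocks_multiply, Matrix.toBlocks_fromBlocks₂₁]
    simp
  · intro h
    have hw := w.2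
    have hM := (Matrix.fromBlocks_toBlocks (w : Matrix (Fin n ⊕ Fin n) (Fin n ⊕ Fin n) F)).symm
    rw [h] at hM
    generalize (w : Matrix (Fin n ⊕ Fin n) (Fin n ⊕ Fin n) F).toBlocks₁₁ = A at hM
    generalize (w : Matrix (Fin n ⊕ Fin n) (Fin n ⊕ Fin n) F).toBlocks₁₂ = B at hM
    generalize (w : Matrix (Fin n ⊕ Fin n) (Fin n ⊕ Fin n) F).toBlocks₂₂ = D at hM
    rw [hM, SymplecticGroup.fromBlocks_mem_iff] at hw
    obtain ⟨-, h2, h3⟩ := hw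
    rw [Matrix.transpose_zero, Matrix.zero_mul, sub_zero] at h3
    have h4 : Dᵀ * A = 1 := by
      rw [← Matrix.transpose_transpose A, ← Matrix.transpose_mul, h3, Matrix.transpose_one]
    have h5 : A * Dᵀ = 1 := mul_eq_one_comm.1 h4
    refine ⟨⟨A, Dᵀ, h5, h4⟩, Dᵀ * B, ?_, ?_⟩
    · rw [Matrix.transpose_mul, Matrix.transpose_transpose, h2]
    · rw [hM, Matrix.fromBlocks_multiply]
      simp [← Matrix.mul_assoc, h5]

variable (F) in
/-- The Siegel parabolic as a subgroup. -/
def siegelSubgroup (n : ℕ) : Subgroup (Matrix.symplecticGroup (Fin n) F) where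
  carrier := siegelParabolic n F
  mul_mem' {v w} hv hw := by
    rw [mem_siegelParabolic_iff] at *
    rw [Submonoid.coe_mul, ← Matrix.fromBlocks_toBlocks v.1, ← Matrix.fromBlocks_toBlocks w.1,
      Matrix.fromBlocks_multiply, hv, hw]
    simp
  one_mem' := by
    rw [mem_siegelParabolic_iff, Submonoid.coe_one, ← Matrix.fromBlocks_one,
      Matrix.toBlocks_fromBlocks₂₁]
  inv_mem' {w} hw := by
    rw [mem_siegelParabolic_iff] at *
    rw [SymplecticGroup.coe_inv, ← Matrix.fromBlocks_toBlocks w.1, hw, Matrix.J,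
      Matrix.fromBlocks_transpose, Matrix.fromBlocks_neg, Matrix.fromBlocks_multiply,
      Matrix.fromBlocks_multiply]
    simp

theorem siegel_mem {n : ℕ} (A : GL (Fin n) F) {B : Matrix (Fin n) (Fin n) F} (hB : B.IsSymm) :
    Matrix.fromBlocks (A : Matrix (Fin n) (Fin n) F) ((A : Matrix (Fin n) (Fin n) F) * B) 0
      ((A⁻¹ : GL (Fin n) F) : Matrix (Fin n) (Fin n) F)ᵀ ∈ Matrix.symplecticGroup (Fin n) F := by
  rw [SymplecticGroup.fromBlocks_mem_iff]
  have h : (A : Matrix (Fin n) (Fin n) F)ᵀ * ((A⁻¹ : GL (Fin n) F) : Matrix (Fin n) (Fin n) F)ᵀ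
      = 1 := by
    rw [← Matrix.transpose_mul, Units.inv_mul, Matrix.transpose_one]
  refine ⟨by simp, ?_, ?_⟩
  · rw [Matrix.transpose_mul, Matrix.mul_assoc, h, Matrix.transpose_transpose, ← Matrix.mul_assoc,
      Units.inv_mul, hB.eq, Matrix.mul_one, Matrix.one_mul]
  · rw [h, Matrix.transpose_zero, Matrix.zero_mul, sub_zero]

/-- The parametrization of the Siegel parabolic by its Levi part and its unipotent part. -/
noncomputable def siegelEquiv (n : ℕ) :
    (GL (Fin n) F × SymmMatrix F (Fin n)) ≃ siegelSubgroup F n :=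
  Equiv.ofBijective (fun p => ⟨⟨_, siegel_mem p.1 p.2.2⟩, mem_siegelParabolic_iff.2 rfl⟩) <| by
    constructor
    · rintro ⟨A, B⟩ ⟨A', B'⟩ h
      have h' := Matrix.fromBlocks_inj.1 (Subtype.ext_iff.1 (Subtype.ext_iff.1 h))
      obtain rfl : A = A' := Units.ext h'.1
      exact Prod.ext rfl (Subtype.ext (A.isUnit.mul_left_cancel h'.2.1))
    · rintro ⟨w, A, B, hB, hw⟩
      refine ⟨⟨A, B, hB⟩, Subtype.ext (Subtype.ext ?_)⟩
      rw [hw, Matrix.fromBlocks_multiply]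
      simp

theorem coe_siegelEquiv {n : ℕ} (p : GL (Fin n) F × SymmMatrix F (Fin n)) :
    ((siegelEquiv n p : Matrix.symplecticGroup (Fin n) F) :
      Matrix (Fin n ⊕ Fin n) (Fin n ⊕ Fin n) F) =
    Matrix.fromBlocks (p.1 : Matrix (Fin n) (Fin n) F) ((p.1 : Matrix (Fin n) (Fin n) F) * p.2.1) 0
      ((p.1⁻¹ : GL (Fin n) F) : Matrix (Fin n) (Fin n) F)ᵀ := rfl

variable {r k : ℕ}

variable (F r k) in
/-- Reindexing of square matrices along `Fin r ⊕ Fin k ≃ Fin (r + k)`. -/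
def finSumReindex : Matrix (Fin r ⊕ Fin k) (Fin r ⊕ Fin k) F ≃ₐ[F]
    Matrix (Fin (r + k)) (Fin (r + k)) F :=
  Matrix.reindexAlgEquiv F F finSumFinEquiv

theorem trace_finSumReindex (M : Matrix (Fin r ⊕ Fin k) (Fin r ⊕ Fin k) F) :
    (finSumReindex F r k M).trace = M.trace :=
  trace_submatrix_equiv M finSumFinEquiv.symm

theorem sigmaMatrix_eq : sigmaMatrix (r + k) F r =
    Matrix.fromBlocks (finSumReindex F r k (Matrix.fromBlocks 0 0 0 1))
      (finSumReindex F r k (Matrix.fromBlocks 1 0 0 0))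
      (finSumReindex F r k (Matrix.fromBlocks 1 0 0 0))
      (finSumReindex F r k (Matrix.fromBlocks 0 0 0 1)) := by
  have h1 : (Matrix.diagonal fun i : Fin (r + k) => if i.val < r then (1 : F) else 0) =
      finSumReindex F r k (Matrix.fromBlocks 1 0 0 0) := by
    rw [← AlgEquiv.symm_apply_eq]
    ext (i | i) (j | j) <;>
      simp [finSumReindex, Matrix.diagonal_apply, Matrix.one_apply, Fin.ext_iff]
    intro h
    omega
  have h2 : (Matrix.diagonal fun i : Fin (r + k) => if i.val < r then (0 : F) else 1) =
      finSumReindex F r k (Matrix.fromBlocks 0 0 0 1) := by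
    rw [← AlgEquiv.symm_apply_eq]
    ext (i | i) (j | j) <;>
      simp [finSumReindex, Matrix.diagonal_apply, Matrix.one_apply, Fin.ext_iff]
    intro h
    omega
  rw [sigmaMatrix, h1, h2]

variable (F r k) in
/-- The parametrization of the Siegel parabolic of `Sp(2(r + k))` in block coordinates. -/
noncomputable def siegelBlockEquiv :
    (GL (Fin r ⊕ Fin k) F × SymmMatrix F (Fin r ⊕ Fin k)) ≃ siegelSubgroup F (r + k) :=
  (Equiv.prodCongr (Units.mapEquiv (finSumReindex F r k : _ ≃* _)).toEquiv
    ((finSumReindex F r k).toEquiv.subtypeEquiv fun B => by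
      rw [Matrix.IsSymm, Matrix.IsSymm]
      exact ((finSumReindex F r k).injective.eq_iff (a := Bᵀ) (b := B)).symm)).trans
    (siegelEquiv (r + k))

theorem coe_siegelBlockEquiv (p : GL (Fin r ⊕ Fin k) F × SymmMatrix F (Fin r ⊕ Fin k)) :
    ((siegelBlockEquiv F r k p : Matrix.symplecticGroup (Fin (r + k)) F) :
      Matrix (Fin (r + k) ⊕ Fin (r + k)) (Fin (r + k) ⊕ Fin (r + k)) F) =
    Matrix.fromBlocks (finSumReindex F r k p.1) (finSumReindex F r k (p.1 * p.2.1)) 0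
      (finSumReindex F r k
        ((p.1⁻¹ : GL (Fin r ⊕ Fin k) F) : Matrix (Fin r ⊕ Fin k) (Fin r ⊕ Fin k) F)ᵀ) := by
  rw [map_mul]
  exact coe_siegelEquiv _

theorem card_siegelSubgroup : Nat.card (siegelSubgroup F (r + k)) =
    Nat.card (GL (Fin (r + k)) F) * Nat.card (SymmMatrix F (Fin (r + k))) := by
  rw [← Nat.card_prod, Nat.card_congr (siegelEquiv _)]

variable [CharP F 2]

theorem coe_sigma (n s : ℕ) : (sigma n F s : Matrix (Fin n ⊕ Fin n) (Fin n ⊕ Fin n) F) =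
    sigmaMatrix n F s := rfl

theorem trace_siegel_mul_sigma (p : GL (Fin r ⊕ Fin k) F × SymmMatrix F (Fin r ⊕ Fin k)) :
    Matrix.trace ((siegelBlockEquiv F r k p * sigma (r + k) F r :
      Matrix.symplecticGroup (Fin (r + k)) F) :
        Matrix (Fin (r + k) ⊕ Fin (r + k)) (Fin (r + k) ⊕ Fin (r + k)) F) =
    (p.1 : Matrix (Fin r ⊕ Fin k) (Fin r ⊕ Fin k) F).toBlocks₂₂.trace +
      ((p.1⁻¹ : GL (Fin r ⊕ Fin k) F) :
        Matrix (Fin r ⊕ Fin k) (Fin r ⊕ Fin k) F).toBlocks₂₂.trace +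
      (Matrix.fromBlocks (p.1 : Matrix (Fin r ⊕ Fin k) (Fin r ⊕ Fin k) F).toBlocks₁₁
        (p.1 : Matrix (Fin r ⊕ Fin k) (Fin r ⊕ Fin k) F).toBlocks₁₂ 0 0 * p.2.1).trace := by
  have h1 : ∀ M : Matrix (Fin r ⊕ Fin k) (Fin r ⊕ Fin k) F,
      (M * Matrix.fromBlocks 0 0 0 1).trace = M.toBlocks₂₂.trace := by
    intro M
    conv_lhs => rw [← Matrix.fromBlocks_toBlocks M]
    rw [Matrix.fromBlocks_multiply, trace_fromBlocks_add]
    simp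
  have h2 : ∀ M : Matrix (Fin r ⊕ Fin k) (Fin r ⊕ Fin k) F,
      Matrix.fromBlocks 1 0 0 0 * M = Matrix.fromBlocks M.toBlocks₁₁ M.toBlocks₁₂ 0 0 := by
    intro M
    conv_lhs => rw [← Matrix.fromBlocks_toBlocks M]
    rw [Matrix.fromBlocks_multiply]
    simp
  rw [Submonoid.coe_mul, coe_siegelBlockEquiv, coe_sigma, sigmaMatrix_eq, Matrix.fromBlocks_multiply,
    trace_fromBlocks_add, Matrix.trace_add]
  simp only [← map_mul, trace_finSumReindex, Matrix.zero_mul, zero_add, h1]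
  rw [← h2, Matrix.mul_assoc (Matrix.fromBlocks 1 0 0 0),
    Matrix.trace_mul_comm (Matrix.fromBlocks 1 0 0 0)]
  have h3 : ∀ M : Matrix (Fin r ⊕ Fin k) (Fin r ⊕ Fin k) F,
      Mᵀ.toBlocks₂₂.trace = M.toBlocks₂₂.trace := fun M => rfl
  rw [h3]
  ring

theorem sigma_mul_self : sigma (r + k) F r * sigma (r + k) F r = 1 := by
  refine Subtype.ext ?_
  rw [Submonoid.coe_mul, coe_sigma, sigmaMatrix_eq, Matrix.fromBlocks_multiply]
  simp only [← map_mul, ← map_add, Matrix.fromBlocks_multiply, Matrix.fromBlocks_add]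
  simp

/-- The lower left block of `σhσ` is `[[(AB)₁₁, A₁₂], [(ᵗA⁻¹)₂₁, 0]]`. Once `A₁₂ = 0`, the entry
`(ᵗA⁻¹)₂₁` vanishes too and `(AB)₁₁ = A₁₁B₁₁` with `A₁₁` invertible. -/
theorem conj_sigma_mem_iff (p : GL (Fin r ⊕ Fin k) F × SymmMatrix F (Fin r ⊕ Fin k)) :
    (sigma (r + k) F r)⁻¹ * siegelBlockEquiv F r k p * sigma (r + k) F r ∈
      siegelSubgroup F (r + k) ↔
    (p.1 : Matrix (Fin r ⊕ Fin k) (Fin r ⊕ Fin k) F).toBlocks₁₂ = 0 ∧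
      p.2.1.toBlocks₁₁ = 0 := by
  rw [inv_eq_of_mul_eq_one_left sigma_mul_self]
  change _ ∈ siegelParabolic _ F ↔ _
  rw [mem_siegelParabolic_iff, Submonoid.coe_mul, Submonoid.coe_mul, coe_siegelBlockEquiv, coe_sigma,
    sigmaMatrix_eq, Matrix.fromBlocks_multiply, Matrix.fromBlocks_multiply,
    Matrix.toBlocks_fromBlocks₂₁]
  simp only [← map_mul, ← map_add, Matrix.mul_zero, add_zero,
    EmbeddingLike.map_eq_zero_iff]
  have key : ∀ M N D : Matrix (Fin r ⊕ Fin k) (Fin r ⊕ Fin k) F,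
      Matrix.fromBlocks 1 0 0 0 * M * Matrix.fromBlocks 0 0 0 1 +
        (Matrix.fromBlocks 1 0 0 0 * N + Matrix.fromBlocks 0 0 0 1 * D) *
          Matrix.fromBlocks 1 0 0 0 =
      Matrix.fromBlocks N.toBlocks₁₁ M.toBlocks₁₂ D.toBlocks₂₁ 0 := by
    intro M N D
    conv_lhs => rw [← Matrix.fromBlocks_toBlocks M, ← Matrix.fromBlocks_toBlocks N,
      ← Matrix.fromBlocks_toBlocks D]
    simp only [Matrix.fromBlocks_multiply, Matrix.fromBlocks_add]
    simp
  obtain ⟨A, B, hB⟩ := p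
  have hAB : ((A : Matrix (Fin r ⊕ Fin k) (Fin r ⊕ Fin k) F) * B).toBlocks₁₁ =
      (A : Matrix (Fin r ⊕ Fin k) (Fin r ⊕ Fin k) F).toBlocks₁₁ * B.toBlocks₁₁ +
      (A : Matrix (Fin r ⊕ Fin k) (Fin r ⊕ Fin k) F).toBlocks₁₂ * B.toBlocks₂₁ := by
    conv_lhs => rw [← Matrix.fromBlocks_toBlocks A.1, ← Matrix.fromBlocks_toBlocks B,
      Matrix.fromBlocks_multiply, Matrix.toBlocks_fromBlocks₁₁]
  rw [key, ← Matrix.fromBlocks_zero, Matrix.fromBlocks_inj, hAB]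
  constructor
  · rintro ⟨h1, h2, -, -⟩
    refine ⟨h2, ?_⟩
    rw [h2, Matrix.zero_mul, add_zero] at h1
    exact (isUnit_toBlocks₁₁ h2).mul_right_eq_zero.1 h1
  · rintro ⟨h1, h2⟩
    refine ⟨?_, h1, ?_, rfl⟩
    · rw [h1, show B.toBlocks₁₁ = 0 from h2, Matrix.mul_zero, Matrix.zero_mul, add_zero]
    · exact congrArg Matrix.transpose (toBlocks₁₂_inv_eq_zero h1)

theorem card_conj_sigma_mem : Nat.card {h : siegelSubgroup F (r + k) //
      (sigma (r + k) F r)⁻¹ * h * sigma (r + k) F r ∈ siegelSubgroup F (r + k)} =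
    Nat.card (GL (Fin r) F) * (Nat.card (GL (Fin k) F) * Nat.card (Matrix (Fin k) (Fin r) F)) *
      Nat.card {B : SymmMatrix F (Fin r ⊕ Fin k) // B.1.toBlocks₁₁ = 0} := by
  rw [← Nat.card_prod, ← Nat.card_prod, Nat.card_congr blockLowerEquiv, ← Nat.card_prod]
  exact Nat.card_congr (((siegelBlockEquiv F r k).subtypeEquiv fun p =>
    (conj_sigma_mem_iff p).symm).symm.trans (Equiv.subtypeProdEquivProd
      (p := fun A : GL (Fin r ⊕ Fin k) F =>
        (A : Matrix (Fin r ⊕ Fin k) (Fin r ⊕ Fin k) F).toBlocks₁₂ = 0)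
      (q := fun B : SymmMatrix F (Fin r ⊕ Fin k) => B.1.toBlocks₁₁ = 0)))

end Parabolic

/-! ### The character sum over a general cell `Pσ_rP`. -/

section BruhatCell

variable {F : Type*} [Field F] [Fintype F] [DecidableEq F]

theorem sum_isAlternatingMatrix_ite {ι : Type*} [Fintype ι] [DecidableEq ι]
    [DecidablePred fun M : Matrix ι ι F => IsAlternatingMatrix M] :
    ∑ X : GL ι F, (if IsAlternatingMatrix (X : Matrix ι ι F) then (1 : ℂ) else 0) =
      invertibleAlternatingCard F ι := by
  rw [sum_generalLinearGroup_eq_sum_ite fun M => if IsAlternatingMatrix M then (1 : ℂ) else 0,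
    invertibleAlternatingCard, Nat.card_eq_fintype_card, Fintype.card_subtype,
    Finset.card_eq_sum_ones, Finset.sum_filter, Nat.cast_sum]
  refine Finset.sum_congr rfl fun M _ => ?_
  by_cases h : M.det = 0 <;> simp [h]

theorem sum_toBlocks₁₂_eq_zero {ι κ : Type*} [Fintype ι] [DecidableEq ι] [Fintype κ]
    [DecidableEq κ] [DecidablePred fun M : Matrix ι ι F => IsAlternatingMatrix M]
    (ψ : AddChar F ℂ) :
    ∑ A : GL (ι ⊕ κ) F, (if (A : Matrix (ι ⊕ κ) (ι ⊕ κ) F).toBlocks₁₂ = 0 then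
      (if IsAlternatingMatrix (A : Matrix (ι ⊕ κ) (ι ⊕ κ) F).toBlocks₁₁ then
        ψ ((A : Matrix (ι ⊕ κ) (ι ⊕ κ) F).toBlocks₂₂.trace +
          ((A⁻¹ : GL (ι ⊕ κ) F) : Matrix (ι ⊕ κ) (ι ⊕ κ) F).toBlocks₂₂.trace) else 0) else 0) =
    invertibleAlternatingCard F ι * (Nat.card (Matrix κ ι F) *
      ∑ Y : GL κ F, ψ ((Y : Matrix κ κ F).trace + ((Y⁻¹ : GL κ F) : Matrix κ κ F).trace)) := by
  rw [← Finset.sum_filter, Finset.sum_subtype (p := fun A : GL (ι ⊕ κ) F =>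
    (A : Matrix (ι ⊕ κ) (ι ⊕ κ) F).toBlocks₁₂ = 0) _ (by simp), ← blockLowerEquiv.sum_comp,
    Fintype.sum_prod_type, ← sum_isAlternatingMatrix_ite, Finset.sum_mul]
  refine Finset.sum_congr rfl fun X _ => ?_
  rw [Fintype.sum_prod_type, ite_mul, one_mul, zero_mul]
  have h : ∀ (Y : GL κ F) (Z : Matrix κ ι F),
      (if IsAlternatingMatrix ((blockLowerEquiv (X, Y, Z)).1 :
        Matrix (ι ⊕ κ) (ι ⊕ κ) F).toBlocks₁₁ then
        ψ (((blockLowerEquiv (X, Y, Z)).1 : Matrix (ι ⊕ κ) (ι ⊕ κ) F).toBlocks₂₂.trace +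
          (((blockLowerEquiv (X, Y, Z)).1⁻¹ : GL (ι ⊕ κ) F) :
            Matrix (ι ⊕ κ) (ι ⊕ κ) F).toBlocks₂₂.trace) else 0) =
      if IsAlternatingMatrix (X : Matrix ι ι F) then
        ψ ((Y : Matrix κ κ F).trace + ((Y⁻¹ : GL κ F) : Matrix κ κ F).trace) else 0 :=
    fun Y Z => rfl
  simp_rw [h]
  split_ifs
  · simp [Finset.mul_sum]
  · simp

variable [CharP F 2] {r k : ℕ}

theorem sum_siegel_mul_sigma {ψ : AddChar F ℂ} (hψ : ψ ≠ 1) [Fintype (siegelSubgroup F (r + k))] :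
    ∑ h : siegelSubgroup F (r + k), ψ (Matrix.trace ((h * sigma (r + k) F r :
      Matrix.symplecticGroup (Fin (r + k)) F) :
        Matrix (Fin (r + k) ⊕ Fin (r + k)) (Fin (r + k) ⊕ Fin (r + k)) F)) =
    Nat.card (SymmMatrix F (Fin r ⊕ Fin k)) * (invertibleAlternatingCard F (Fin r) *
      (Nat.card (Matrix (Fin k) (Fin r) F) * kloostermanGL k ψ 1)) := by
  classical
  rw [← (siegelBlockEquiv F r k).sum_comp, Fintype.sum_prod_type]
  simp_rw [trace_siegel_mul_sigma, AddChar.map_add_eq_mul ψ (_ + _) _]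
  -- The sum over `B` keeps only alternating `[[A₁₁, A₁₂], [0, 0]]`, and the zero lower left block
  -- forces `A₁₂ = 0`.
  simp_rw [← Finset.mul_sum, sum_symmMatrix_addChar hψ]
  have hK : kloostermanGL k ψ 1 = ∑ Y : GL (Fin k) F, ψ ((Y : Matrix (Fin k) (Fin k) F).trace +
      ((Y⁻¹ : GL (Fin k) F) : Matrix (Fin k) (Fin k) F).trace) := by
    simp [kloostermanGL]
  rw [hK, ← sum_toBlocks₁₂_eq_zero, Finset.mul_sum]
  refine Finset.sum_congr rfl fun A _ => ?_
  simp only [isAlternatingMatrix_fromBlocks, isAlternatingMatrix_zero, and_true,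
    eq_comm (a := (0 : Matrix (Fin k) (Fin r) F)), neg_eq_zero, Matrix.transpose_eq_zero]
  by_cases h1 : (A : Matrix (Fin r ⊕ Fin k) (Fin r ⊕ Fin k) F).toBlocks₁₂ = 0 <;>
    by_cases h2 : IsAlternatingMatrix
      (A : Matrix (Fin r ⊕ Fin k) (Fin r ⊕ Fin k) F).toBlocks₁₁ <;> simp [h1, h2, mul_comm]

/-- After `|P|` and the stabilizer order are inserted, the factors for the free block `A₂₁` and for
symmetric `B` with `B₁₁ = 0` occur on both sides and cancel. -/
theorem sum_bruhatCell {ψ : AddChar F ℂ} (hψ : ψ ≠ 1) :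
    (Nat.card (GL (Fin r) F) * Nat.card (GL (Fin k) F) : ℂ) *
      ∑ w ∈ bruhatCell (r + k) F r, ψ (Matrix.trace
        (w : Matrix (Fin (r + k) ⊕ Fin (r + k)) (Fin (r + k) ⊕ Fin (r + k)) F)) =
    Nat.card (GL (Fin (r + k)) F) * Nat.card (SymmMatrix F (Fin r)) *
      Nat.card (SymmMatrix F (Fin (r + k))) * invertibleAlternatingCard F (Fin r) *
      kloostermanGL k ψ 1 := by
  have := Fintype.ofFinite (siegelSubgroup F (r + k))
  have h := card_mul_sum_doubleCoset (siegelSubgroup F (r + k)) (sigma (r + k) F r)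
    (fun w => ψ (Matrix.trace
        (w : Matrix (Fin (r + k) ⊕ Fin (r + k)) (Fin (r + k) ⊕ Fin (r + k)) F)))
    (fun x y => by rw [Submonoid.coe_mul, Submonoid.coe_mul, Matrix.trace_mul_comm])
    (bruhatCell (r + k) F r) (fun w => by rw [bruhatCell, Set.Finite.mem_toFinset]; rfl)
  rw [sum_siegel_mul_sigma hψ, card_conj_sigma_mem, ← Nat.card_eq_fintype_card,
    card_siegelSubgroup, card_symmMatrix_sum] at h
  have h1 : (Nat.card (Matrix (Fin k) (Fin r) F) : ℂ) ≠ 0 := by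
    exact_mod_cast Nat.card_pos.ne'
  have h2 : (Nat.card {B : SymmMatrix F (Fin r ⊕ Fin k) // B.1.toBlocks₁₁ = 0} : ℂ) ≠ 0 := by
    have : Nonempty {B : SymmMatrix F (Fin r ⊕ Fin k) // B.1.toBlocks₁₁ = 0} :=
      ⟨⟨⟨0, Matrix.isSymm_zero⟩, rfl⟩⟩
    exact_mod_cast Nat.card_pos.ne'
  apply mul_left_cancel₀ (mul_ne_zero h1 h2)
  push_cast at h
  linear_combination h

end BruhatCell

/-! ### Orders of general linear groups. -/

section Cardinalities

variable {F : Type*} [Field F] [Fintype F]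

theorem card_GL_succ (n : ℕ) : (Nat.card (GL (Fin (n + 1)) F) : ℂ) =
    ((Fintype.card F : ℂ) ^ (n + 1) - 1) * (Fintype.card F : ℂ) ^ n * Nat.card (GL (Fin n) F) := by
  have h : ∀ n : ℕ, (Nat.card (GL (Fin n) F) : ℂ) =
      ∏ i : Fin n, ((Fintype.card F : ℂ) ^ n - (Fintype.card F : ℂ) ^ (i : ℕ)) := by
    intro n
    rw [Matrix.card_GL_field, Nat.cast_prod]
    refine Finset.prod_congr rfl fun i _ => ?_
    rw [Nat.cast_sub (Nat.pow_le_pow_right Fintype.card_pos i.2.le)]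
    push_cast
    rfl
  have h' : ∏ i : Fin n, ((Fintype.card F : ℂ) ^ (n + 1) - (Fintype.card F : ℂ) ^ (i + 1 : ℕ)) =
      (Fintype.card F : ℂ) ^ n *
        ∏ i : Fin n, ((Fintype.card F : ℂ) ^ n - (Fintype.card F : ℂ) ^ (i : ℕ)) := by
    simp_rw [pow_succ', ← mul_sub]
    simp [Finset.prod_mul_distrib]
  rw [h, h, Fin.prod_univ_succ, mul_assoc]
  simp only [Fin.val_zero, pow_zero, Fin.val_succ, h']

theorem card_GL_fin_one : (Nat.card (GL (Fin 1) F) : ℂ) = (Fintype.card F : ℂ) ^ 1 - 1 := by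
  simpa using card_GL_succ (F := F) 0

theorem card_GL_fin_two : (Nat.card (GL (Fin 2) F) : ℂ) =
    ((Fintype.card F : ℂ) ^ 2 - 1) * Fintype.card F * ((Fintype.card F : ℂ) ^ 1 - 1) := by
  rw [card_GL_succ, card_GL_fin_one]
  simp

theorem card_pow_sub_one_ne_zero {m : ℕ} (hm : m ≠ 0) : (Fintype.card F : ℂ) ^ m - 1 ≠ 0 := by
  rw [sub_ne_zero]
  exact_mod_cast (Nat.one_lt_pow hm Fintype.one_lt_card).ne'

theorem card_GL_ne_zero (n : ℕ) : (Nat.card (GL (Fin n) F) : ℂ) ≠ 0 := by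
  exact_mod_cast Nat.card_pos.ne'

end Cardinalities

/-! ### The cells for odd and even `n`, and the final statement. -/

section DoubleCosetCharacterSums

variable {F : Type*} [Field F] [Fintype F] [DecidableEq F] [CharP F 2]

theorem sum_DCminus {ψ : AddChar F ℂ} (hψ : ψ ≠ 1) {n : ℕ} (hn : Odd n) :
    ∑ w ∈ DCminus n F, ψ (Matrix.trace (w : Matrix (Fin n ⊕ Fin n) (Fin n ⊕ Fin n) F)) =
      Aminus n (Fintype.card F : ℂ) * kloosterman ψ 1 := by
  obtain ⟨l, rfl⟩ := hn
  have h := sum_bruhatCell (r := 2 * l) (k := 1) hψ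
  have h1 := card_pow_sub_one_ne_zero (F := F) one_ne_zero
  have h1' : (Fintype.card F : ℂ) - 1 ≠ 0 := by rwa [pow_one] at h1
  have hg := card_GL_ne_zero (F := F) (2 * l)
  have hl : l * (l - 1) + l = l * l := by cases l <;> simp [mul_add]
  -- The powers of `q` come, in order, from `|GL(2l+1)| / |GL(2l)|`, symmetric matrices of sizes
  -- `2l` and `2l+1`, and the alternating count.
  have he : (5 * (2 * l + 1) ^ 2 - 1) / 4 =
      2 * l + l * (2 * l + 1) + (2 * l + 1) * (l + 1) + l * (l - 1) := by
    have : 5 * (2 * l + 1) ^ 2 =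
        4 * (2 * l + l * (2 * l + 1) + (2 * l + 1) * (l + 1) + l * (l - 1)) + 1 := by linarith
    omega
  rw [card_GL_succ (2 * l), card_GL_fin_one,
    card_symmMatrix_fin (2 * l) (l * (2 * l + 1)) (by ring),
    card_symmMatrix_fin (2 * l + 1) ((2 * l + 1) * (l + 1)) (by ring),
    invertibleAlternatingCard_fin_even, kloostermanGL_one] at h
  rw [Aminus, he, qBinomial, Finset.prod_range_one, Nat.sub_zero, Nat.sub_zero,
    show (2 * l + 1 - 1) / 2 = l by omega, pow_add, pow_add, pow_add]
  apply mul_left_cancel₀ (mul_ne_zero hg h1)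
  refine h.trans ?_
  field_simp

theorem sum_DCplus {ψ : AddChar F ℂ} (hψ : ψ ≠ 1) {n : ℕ} (hn : Even n) (h2 : 2 ≤ n) :
    ∑ w ∈ DCplus n F, ψ (Matrix.trace (w : Matrix (Fin n ⊕ Fin n) (Fin n ⊕ Fin n) F)) =
      (Fintype.card F : ℂ)⁻¹ * Aplus n (Fintype.card F : ℂ) * kloostermanGL 2 ψ 1 := by
  obtain ⟨l, rfl⟩ : ∃ l, n = 2 * l + 2 := by
    obtain ⟨m, rfl⟩ := hn
    exact ⟨m - 1, by omega⟩
  have h := sum_bruhatCell (r := 2 * l) (k := 2) hψ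
  have h1 := card_pow_sub_one_ne_zero (F := F) one_ne_zero
  have h1' : (Fintype.card F : ℂ) - 1 ≠ 0 := by rwa [pow_one] at h1
  have h2 := card_pow_sub_one_ne_zero (F := F) two_ne_zero
  have hq : (Fintype.card F : ℂ) ≠ 0 := by simp
  have hg := card_GL_ne_zero (F := F) (2 * l)
  have hl : l * (l - 1) + l = l * l := by cases l <;> simp [mul_add]
  -- Here `|GL(2l+2)| / |GL(2l)|` supplies `2l + 2l + 1`; the factor `q` in `|GL(2)|` accounts for
  -- the `q⁻¹` in the statement.
  have he : (5 * (2 * l + 2) ^ 2 - 2 * (2 * l + 2)) / 4 =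
      2 * l + 2 * l + l * (2 * l + 1) + (l + 1) * (2 * l + 3) + l * (l - 1) + 1 := by
    have : 5 * (2 * l + 2) ^ 2 = 4 * (2 * l + 2 * l + l * (2 * l + 1) + (l + 1) * (2 * l + 3) +
        l * (l - 1) + 1) + 2 * (2 * l + 2) := by linarith
    omega
  rw [card_GL_succ (2 * l + 1), card_GL_succ (2 * l), card_GL_fin_two,
    card_symmMatrix_fin (2 * l) (l * (2 * l + 1)) (by ring),
    card_symmMatrix_fin (2 * l + 2) ((l + 1) * (2 * l + 3)) (by ring),
    invertibleAlternatingCard_fin_even] at h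
  rw [Aplus, he, qBinomial, Finset.prod_range_succ, Finset.prod_range_one,
    show (2 * l + 2 - 2) / 2 = l by omega, Nat.sub_zero, Nat.sub_zero,
    show 2 * l + 2 - 1 = 2 * l + 1 by omega, show 2 - 1 = 1 from rfl]
  apply mul_left_cancel₀ (mul_ne_zero hg (mul_ne_zero (mul_ne_zero h2 hq) h1))
  refine h.trans ?_
  simp only [pow_add]
  field_simp

theorem sum_DCplus' {ψ : AddChar F ℂ} (hψ : ψ ≠ 1) {n : ℕ} (hn : Even n) (h2 : 2 ≤ n) :
    ∑ w ∈ DCplus n F, ψ (Matrix.trace (w : Matrix (Fin n ⊕ Fin n) (Fin n ⊕ Fin n) F)) =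
      Aplus n (Fintype.card F : ℂ) *
        (kloosterman ψ 1 ^ 2 + (Fintype.card F : ℂ) ^ 2 - (Fintype.card F : ℂ)) := by
  have hq : (Fintype.card F : ℂ) ≠ 0 := by simp
  rw [sum_DCplus hψ hn h2, kloostermanGL_two ψ hψ]
  field_simp

end DoubleCosetCharacterSums

theorem theorem4 {F : Type*} [Field F] [Fintype F] [DecidableEq F] [CharP F 2] :
    (∀ ψ : AddChar F ℂ, ψ ≠ 1 →
      (∀ n : ℕ, Odd n →
        ∑ w ∈ DCminus n F, ψ (Matrix.trace (w : Matrix (Fin n ⊕ Fin n) (Fin n ⊕ Fin n) F)) =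
          Aminus n (Fintype.card F : ℂ) * kloosterman ψ 1) ∧
      (∀ n : ℕ, Even n → 2 ≤ n →
        ∑ w ∈ DCplus n F, ψ (Matrix.trace (w : Matrix (Fin n ⊕ Fin n) (Fin n ⊕ Fin n) F)) =
          (Fintype.card F : ℂ)⁻¹ * Aplus n (Fintype.card F : ℂ) * kloostermanGL 2 ψ 1 ∧
        ∑ w ∈ DCplus n F, ψ (Matrix.trace (w : Matrix (Fin n ⊕ Fin n) (Fin n ⊕ Fin n) F)) =
          Aplus n (Fintype.card F : ℂ) *
            (kloosterman ψ 1 ^ 2 + (Fintype.card F : ℂ) ^ 2 - (Fintype.card F : ℂ)))) ∧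
    (∀ a : Fˣ,
      (∀ n : ℕ, Odd n →
        ∑ w ∈ DCminus n F, canonicalChar F
            ((a : F) * Matrix.trace (w : Matrix (Fin n ⊕ Fin n) (Fin n ⊕ Fin n) F)) =
          Aminus n (Fintype.card F : ℂ) * kloosterman (canonicalChar F) a) ∧
      (∀ n : ℕ, Even n → 2 ≤ n →
        ∑ w ∈ DCplus n F, canonicalChar F
            ((a : F) * Matrix.trace (w : Matrix (Fin n ⊕ Fin n) (Fin n ⊕ Fin n) F)) =
          Aplus n (Fintype.card F : ℂ) *
            (kloosterman (canonicalChar F) a ^ 2 +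
              (Fintype.card F : ℂ) ^ 2 - (Fintype.card F : ℂ)) ∧
        ∑ w ∈ DCplus n F, canonicalChar F
            ((a : F) * Matrix.trace (w : Matrix (Fin n ⊕ Fin n) (Fin n ⊕ Fin n) F)) =
          Aplus n (Fintype.card F : ℂ) *
            (multiKloosterman 2 (canonicalChar F) a + (Fintype.card F : ℂ) ^ 2))) := by
  refine ⟨fun ψ hψ => ⟨fun n hn => sum_DCminus hψ hn, fun n hn h2 =>
    ⟨sum_DCplus hψ hn h2, sum_DCplus' hψ hn h2⟩⟩, fun a => ?_⟩
  -- The twisted character `x ↦ λ(ax)` is nontrivial, so the general case applies to it.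
  have hψ : (canonicalChar F).mulShift (a : F) ≠ 1 := canonicalChar_isPrimitive a.ne_zero
  refine ⟨fun n hn => ?_, fun n hn h2 => ?_⟩
  · rw [← kloosterman_mulShift, ← sum_DCminus hψ hn]
    rfl
  · have h := sum_DCplus' hψ hn h2
    rw [kloosterman_mulShift] at h
    refine ⟨h, h.trans ?_⟩
    rw [kloosterman_sq_eq]
    ring
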